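/- Let $L$ be a nonzero finite-dimensional Lie algebra over a field $\mathbb{F}$ of characteristic zero, with only finitely many ideals, and let $S$ be a Levi factor of $L$ (a semisimple subalgebra, possibly $0$, with $L=S\oplus\mathrm{Rad}(L)$; $\oplus$ denotes a direct sum of vector spaces). Notation: $\mathrm{Rad}(L)$ and $\mathrm{Nil}(L)$ are the solvable and nilpotent radicals, $\mathcal{J}(L)$ is the intersection of all maximal ideals of $L$, $L^2=[L,L]$, $C_L(\cdot)$ denotes the centralizer in $L$ and $Z(\cdot)$ the centre, $\mathrm{Asoc}(L)$ is the sum of all abelian minimal ideals of $L$, $Z_0(\mathrm{Nil}(L))=\{x\in Z(\mathrm{Nil}(L)) : [S,x]=0\}$, and $Z_1(\mathrm{Nil}(L))$ is the sum of all nontrivial irreducible $\mathrm{ad}\,S$-submodules of $Z(\mathrm{Nil}(L))$. $L$ is called faithful if no nonzero element of $S$ centralizes $\mathrm{Rad}(L)$, and centreless if $Z(L)=0$. The elements $a,z$ below are nonzero. Then: (a) Either $L=L^2=S\oplus\mathcal{J}(L)$ with $S\neq 0$ and $\mathrm{Rad}(L)=\mathcal{J}(L)=\mathrm{Nil}(L)$,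 or there is $a\in L$ with $L=L^2\oplus\mathbb{F}a$ and $\mathrm{Rad}(L)=\mathcal{J}(L)\oplus\mathbb{F}a$. Moreover, if $S=0$ and $\mathcal{J}(L)\neq 0$, then $L^2=\mathcal{J}(L)=\mathrm{Nil}(L)$. (b) $\dim Z(L)\leq 1$. (c) $C_L(L^2)\nsubseteq L^2$ if and only if there is $z\in L$ with $L=L^2\oplus\mathbb{F}z$ and $C_L(L^2)=Z(L)=\mathbb{F}z$. In this case $L^2$ is a centreless Lie algebra with finitely many ideals, and $(L^2)^2=L^2$. (d) $C_L(L^2)$ is an abelian ideal of $L$, and $Z(L)\subseteq Z_0(\mathrm{Nil}(L))\subseteq C_L(L^2)$. If $S=0$, then $Z_0(\mathrm{Nil}(L))=Z(\mathrm{Nil}(L))$. (e) $Z(\mathrm{Nil}(L))=Z_0(\mathrm{Nil}(L))\oplus Z_1(\mathrm{Nil}(L))$ and $Z_1(\mathrm{Nil}(L))\subseteq\mathcal{J}(L)$. (f) Either there is $z\in L$ with $L=L^2\oplus\mathbb{F}z$ and $C_L(L^2)=Z(L)=\mathbb{F}z=Z_0(\mathrm{Nil}(L))$, or $Z(\mathrm{Nil}(L))\subseteq\mathcal{J}(L)$.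 (g) The ideals $I$ of $L$ with $I\cap\mathcal{J}(L)=0$ are exactly: the zero ideal, the sums $I_s$ of simple ideals of $L$ and, if $L=L^2\oplus Z(L)$ with $Z(L)=\mathbb{F}z\neq 0$, also $Z(L)$ and the ideals $I_s\oplus Z(L)$. (h) If $L$ is faithful and centreless, then $I\cap\mathcal{J}(L)\neq 0$ for every nonzero ideal $I$ of $L$. (i) $\mathrm{Asoc}(L)\subseteq Z(\mathrm{Nil}(L))$, and either there is $z\in L$ with $\mathrm{Asoc}(L)=Z(\mathrm{Nil}(L))=(\mathrm{Asoc}(L)\cap\mathcal{J}(L))\oplus\mathbb{F}z$ and $Z(L)=\mathbb{F}z=Z_0(\mathrm{Nil}(L))$, or $Z(\mathrm{Nil}(L))\subseteq\mathcal{J}(L)$. (j) Every homomorphic image of $L$ has finitely many ideals; hence, for every proper ideal $I$ of $L$, the quotient $L/I$ satisfies (a)–(i) (for each of its Levi factors). -/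

import Mathlib

namespace LieIdeals

section

variable (F : Type*) (L : Type*) [Field F] [LieRing L] [LieAlgebra F L]

/-- The derived ideal `L² = [L, L]`. -/
def derived : LieIdeal F L := ⁅(⊤ : LieIdeal F L), (⊤ : LieIdeal F L)⁆

/-- The Jacobson radical `J(L)`: the intersection of all maximal ideals of `L`. -/
def jacobson : LieIdeal F L := sInf {I : LieIdeal F L | IsCoatom I}

/-- The nilpotent radical `Nil(L)`: the sum of all ideals of `L` that are nilpotent Lie algebras.
(Mathlib's `LieAlgebra.maxNilpotentIdeal` is a different ideal: it is the largest ideal on which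
`L` itself, and not only the ideal, acts nilpotently.) -/
def nilradical : LieIdeal F L := sSup {I : LieIdeal F L | LieRing.IsNilpotent I}

variable {F L}

/-- The centralizer `C_L(I)` of an ideal `I`, as a subspace of `L`. -/
def centralizer (I : LieIdeal F L) : Submodule F L where
  carrier := {x | ∀ y ∈ I, ⁅x, y⁆ = 0}
  zero_mem' := fun y _ => zero_lie y
  add_mem' := fun {x x'} hx hx' y hy => by rw [add_lie, hx y hy, hx' y hy, add_zero]
  smul_mem' := fun c x hx y hy => by rw [smul_lie, hx y hy, smul_zero]

variable (F L)

/-- The centre `Z(Nil(L))` of the nilpotent radical, as a subspace of `L`. -/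
def nilCenter : Submodule F L := (nilradical F L).toSubmodule ⊓ centralizer (nilradical F L)

/-- The abelian socle: the sum of all minimal ideals of `L` that are abelian. -/
def asoc : LieIdeal F L := sSup {I : LieIdeal F L | IsAtom I ∧ IsLieAbelian I}

variable {F L}

/-- A Levi factor: a semisimple subalgebra `S`, possibly zero, such that `L = S ⊕ Rad(L)` as vector
spaces. Here semisimple means that the solvable radical is zero. -/
def IsLeviFactor (S : LieSubalgebra F L) : Prop :=
  LieAlgebra.HasTrivialRadical F S ∧
    IsCompl S.toSubmodule (LieAlgebra.radical F L).toSubmodule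

/-- `Z₀(Nil(L))`: the elements of `Z(Nil(L))` on which `ad S` acts trivially. -/
def nilCenterTriv (S : LieSubalgebra F L) : Submodule F L where
  carrier := {x | x ∈ nilCenter F L ∧ ∀ s ∈ S, ⁅s, x⁆ = 0}
  zero_mem' := ⟨zero_mem _, fun s _ => lie_zero s⟩
  add_mem' := fun {x x'} hx hx' =>
    ⟨add_mem hx.1 hx'.1, fun s hs => by rw [lie_add, hx.2 s hs, hx'.2 s hs, add_zero]⟩
  smul_mem' := fun c x hx =>
    ⟨Submodule.smul_mem _ c hx.1, fun s hs => by rw [lie_smul, hx.2 s hs, smul_zero]⟩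

/-- `Z₁(Nil(L))`: the sum of all nontrivial irreducible `ad S`-submodules of `Z(Nil(L))`. -/
def nilCenterNontriv (S : LieSubalgebra F L) : Submodule F L :=
  sSup {V : Submodule F L | ∃ W : LieSubmodule F S L, V = W.toSubmodule ∧
    V ≤ nilCenter F L ∧ LieModule.IsIrreducible F S W ∧ ¬ LieModule.IsTrivial S W}

/-- `L` is faithful: the adjoint action of the Levi factor `S` on `Rad(L)` is faithful. -/
def IsFaithfulAlg (S : LieSubalgebra F L) : Prop :=
  ∀ s ∈ S, (∀ r ∈ LieAlgebra.radical F L, ⁅s, r⁆ = 0) → s = 0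

/-- `I` is a sum of (possibly no) simple ideals of `L`. -/
def IsSumOfSimpleIdeals (I : LieIdeal F L) : Prop :=
  ∃ T : Set (LieIdeal F L), (∀ K ∈ T, LieAlgebra.IsSimple F K) ∧ I = sSup T

/-- `C = A ⊕ B` as vector spaces. -/
def IsDirectSum (C A B : Submodule F L) : Prop := Disjoint A B ∧ C = A ⊔ B

variable (F L) in
/-- The assertions (a)–(i) for a Lie algebra `L` with Levi factor `S`. A summand `F ∙ z` is always
a line: `z ≠ 0`. -/
structure BasicStructure (S : LieSubalgebra F L) : Prop where
  /-- Either `L = L² = S ⊕ J(L)`, `S ≠ 0`, `Rad(L) = J(L) = Nil(L)`, or `L = L² ⊕ F a` and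
  `Rad(L) = J(L) ⊕ F a`; and `L² = J(L) = Nil(L)` if `S = 0` and `J(L) ≠ 0`. -/
  a : ((derived F L = ⊤ ∧
          IsDirectSum ⊤ S.toSubmodule (jacobson F L).toSubmodule ∧ S ≠ ⊥ ∧
          LieAlgebra.radical F L = jacobson F L ∧ jacobson F L = nilradical F L) ∨
        (∃ a : L, a ≠ 0 ∧
          IsDirectSum ⊤ (derived F L).toSubmodule (F ∙ a) ∧
          IsDirectSum (LieAlgebra.radical F L).toSubmodule
            (jacobson F L).toSubmodule (F ∙ a))) ∧
      (S = ⊥ → jacobson F L ≠ ⊥ →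
        derived F L = jacobson F L ∧ jacobson F L = nilradical F L)
  /-- `dim Z(L) ≤ 1`. -/
  b : Module.finrank F (LieAlgebra.center F L) ≤ 1
  /-- `C_L(L²) ⊄ L²` iff `L = L² ⊕ F z` and `C_L(L²) = Z(L) = F z`; in this case `L²` is
  centreless with finitely many ideals and `(L²)² = L²`. -/
  c : (¬ centralizer (derived F L) ≤ (derived F L).toSubmodule ↔
        ∃ z : L, z ≠ 0 ∧ IsDirectSum ⊤ (derived F L).toSubmodule (F ∙ z) ∧
          centralizer (derived F L) = (LieAlgebra.center F L).toSubmodule ∧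
          (LieAlgebra.center F L).toSubmodule = F ∙ z) ∧
      (¬ centralizer (derived F L) ≤ (derived F L).toSubmodule →
        LieAlgebra.center F (derived F L) = ⊥ ∧
        Finite (LieIdeal F (derived F L)) ∧
        derived F (derived F L) = ⊤)
  /-- `C_L(L²)` is an abelian ideal; `Z(L) ⊆ Z₀(Nil(L)) ⊆ C_L(L²)`; and
  `Z₀(Nil(L)) = Z(Nil(L))` if `S = 0`. -/
  d : (∃ C : LieIdeal F L, C.toSubmodule = centralizer (derived F L) ∧ IsLieAbelian C) ∧
      (LieAlgebra.center F L).toSubmodule ≤ nilCenterTriv S ∧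
      nilCenterTriv S ≤ centralizer (derived F L) ∧
      (S = ⊥ → nilCenterTriv S = nilCenter F L)
  /-- `Z(Nil(L)) = Z₀(Nil(L)) ⊕ Z₁(Nil(L))` and `Z₁(Nil(L)) ⊆ J(L)`. -/
  e : IsDirectSum (nilCenter F L) (nilCenterTriv S) (nilCenterNontriv S) ∧
      nilCenterNontriv S ≤ (jacobson F L).toSubmodule
  /-- Either `L = L² ⊕ F z` and `C_L(L²) = Z(L) = F z = Z₀(Nil(L))`, or `Z(Nil(L)) ⊆ J(L)`. -/
  f : (∃ z : L, z ≠ 0 ∧ IsDirectSum ⊤ (derived F L).toSubmodule (F ∙ z) ∧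
          centralizer (derived F L) = (LieAlgebra.center F L).toSubmodule ∧
          (LieAlgebra.center F L).toSubmodule = F ∙ z ∧
          F ∙ z = nilCenterTriv S) ∨
      nilCenter F L ≤ (jacobson F L).toSubmodule
  /-- The ideals meeting `J(L)` trivially are `0`, the sums `I_s` of simple ideals and, if
  `L = L² ⊕ Z(L)` with `Z(L) = F z`, also `Z(L)` and the ideals `I_s ⊕ Z(L)`. -/
  g : ∀ I : LieIdeal F L, I ⊓ jacobson F L = ⊥ ↔
      (I = ⊥ ∨ IsSumOfSimpleIdeals I ∨
        (IsDirectSum ⊤ (derived F L).toSubmodule (LieAlgebra.center F L).toSubmodule ∧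
          (∃ z : L, z ≠ 0 ∧ (LieAlgebra.center F L).toSubmodule = F ∙ z) ∧
          (I = LieAlgebra.center F L ∨
            ∃ K : LieIdeal F L, IsSumOfSimpleIdeals K ∧
              IsDirectSum I.toSubmodule K.toSubmodule
                (LieAlgebra.center F L).toSubmodule)))
  /-- If `L` is faithful and centreless, every nonzero ideal meets `J(L)` nontrivially. -/
  h : IsFaithfulAlg S → LieAlgebra.center F L = ⊥ →
      ∀ I : LieIdeal F L, I ≠ ⊥ → I ⊓ jacobson F L ≠ ⊥
  /-- `Asoc(L) ⊆ Z(Nil(L))`, and either `Asoc(L) = Z(Nil(L)) = (Asoc(L) ∩ J(L)) ⊕ F z` and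
  `Z(L) = F z = Z₀(Nil(L))`, or `Z(Nil(L)) ⊆ J(L)`. -/
  i : (asoc F L).toSubmodule ≤ nilCenter F L ∧
      ((∃ z : L, z ≠ 0 ∧ (asoc F L).toSubmodule = nilCenter F L ∧
          IsDirectSum (nilCenter F L) (asoc F L ⊓ jacobson F L).toSubmodule (F ∙ z) ∧
          (LieAlgebra.center F L).toSubmodule = F ∙ z ∧
          F ∙ z = nilCenterTriv S) ∨
        nilCenter F L ≤ (jacobson F L).toSubmodule)

end

end LieIdeals

/-!
The structure of `L` rests on three facts about Lie algebras in characteristic zero.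

* Weyl's theorem (`complementedLattice_lieSubmodule`): modules of a semisimple Lie algebra are
  completely reducible. It follows from Whitehead's first lemma (`exists_eq_lie_of_cocycle`), which
  is reduced by induction on the dimension to irreducible modules. There Cartan's criterion allows
  passing to an ideal on which the trace form is nondegenerate, and the Casimir operator of that
  form is invertible.
* `[L, I]` is nilpotent for every solvable ideal `I` (`isNilpotent_lie_top_of_isSolvable`). Over an
  algebraic closure Lie's theorem gives a submodule on which `I` acts by scalars, and a bracket acts
  on it with trace zero, hence by zero.
* An infinite field has infinitely many lines in a plane. Every subspace containing `L²` and every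
  subspace of the centre is an ideal, so finiteness of the set of ideals forces `dim L / L² ≤ 1` and
  `dim Z(L) ≤ 1` (`sup_span_eq_of_finite`).

Let `R` be the solvable radical. The `ad S`-submodules above `[L, R]` are ideals, so Weyl's theorem
gives `J(L) = [L, R]` (`IsLeviFactor.jacobson_eq`), and then `J(L) ≤ Nil(L) ≤ R`,
`L² = S ⊕ J(L)` and `L² ∩ R = J(L)`. Hence `R / J(L)` is at most one-dimensional. An element of
`C_L(L²)` outside `L²` is central, because together with `L²` it spans `L`; if there is none, then
`Z₀(Nil(L)) ≤ C_L(L²) ∩ R ≤ L² ∩ R = J(L)`. By complete reducibility `Z₁(Nil(L))` is the complement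
of `Z₀(Nil(L))` in `Z(Nil(L))`, and it lies in `[S, R] ≤ J(L)`.

If an ideal `I` meets `J(L)` trivially, then `[I, R] = 0`. So `I ∩ R` is central, an
`ad S`-complement of it in `I` is again an ideal of `L`, and this complement is a sum of minimal
ideals, which are simple because ideals meeting `R` trivially have a nondegenerate Killing form.
Such an `I` with `I ∩ R = 0` is perfect and centralizes `R`, which forces `I ≤ S`
(`IsLeviFactor.le_of_inf_radical_eq_bot`); hence it vanishes when `L` is faithful.
-/

namespace LieIdeals

open Module

/-! ### The Casimir operator -/

section Casimir

variable {F S M : Type*} [Field F] [LieRing S] [LieAlgebra F S]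
  [AddCommGroup M] [Module F M] [LieRingModule S M] [LieModule F S M]

/-- The canonical element `∑ bᵢ ⊗ bᵢ'` of an invariant form is invariant: every bilinear map `B`
satisfies `∑ B ⁅x, bᵢ⁆ bᵢ' + B bᵢ ⁅x, bᵢ'⁆ = 0`. -/
theorem sum_lie_dualBasis {ι V : Type*} [Fintype ι] [DecidableEq ι] [AddCommGroup V] [Module F V]
    (τ : LinearMap.BilinForm F S) (hτ : τ.Nondegenerate)
    (hinv : ∀ x y z, τ ⁅x, y⁆ z = τ x ⁅y, z⁆) (b : Basis ι F S) (B : S →ₗ[F] S →ₗ[F] V) (x : S) :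
    ∑ i, B ⁅x, b i⁆ (τ.dualBasis hτ b i) + ∑ i, B (b i) ⁅x, τ.dualBasis hτ b i⁆ = 0 := by
  set b' := τ.dualBasis hτ b with hb'
  have hδ : ∀ i j, τ (b' i) (b j) = if j = i then 1 else 0 :=
    LinearMap.BilinForm.apply_dualBasis_left hτ b
  have h1 : ∀ v, v = ∑ j, τ (b' j) v • b j := fun v => by
    have : ∀ j, τ (b' j) v = b.repr v j := fun j => by
      conv_lhs => rw [← b.sum_repr v]
      simp only [map_sum, map_smul, hδ]
      simp
    simp_rw [this, b.sum_repr]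
  have h2 : ∀ v, v = ∑ j, τ v (b j) • b' j := fun v => by
    have : ∀ j, τ v (b j) = b'.repr v j := fun j => by
      conv_lhs => rw [← b'.sum_repr v]
      simp only [map_sum, map_smul, LinearMap.sum_apply, LinearMap.smul_apply, hδ]
      simp
    simp_rw [this, b'.sum_repr]
  have e1 : ∑ i, B ⁅x, b i⁆ (b' i) = ∑ i, ∑ j, τ (b' j) ⁅x, b i⁆ • B (b j) (b' i) := by
    refine Finset.sum_congr rfl fun i _ => ?_
    conv_lhs => rw [h1 ⁅x, b i⁆]
    simp
  have e2 : ∑ i, B (b i) ⁅x, b' i⁆ = ∑ i, ∑ j, τ ⁅x, b' i⁆ (b j) • B (b i) (b' j) := by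
    refine Finset.sum_congr rfl fun i _ => ?_
    conv_lhs => rw [h2 ⁅x, b' i⁆]
    simp
  rw [e1, e2, Finset.sum_comm (f := fun i j => τ ⁅x, b' i⁆ (b j) • B (b i) (b' j)),
    ← Finset.sum_add_distrib]
  refine Finset.sum_eq_zero fun i _ => ?_
  rw [← Finset.sum_add_distrib]
  refine Finset.sum_eq_zero fun j _ => ?_
  rw [← add_smul, ← hinv, ← lie_skew x (b' j), map_neg, LinearMap.neg_apply, add_neg_cancel,
    zero_smul]

/-- The Casimir argument: if the trace form of an irreducible module is nondegenerate, the
Casimir operator `c` is invertible, having trace `dim S`, and a cocycle `f` satisfies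
`c (f x) = ⁅x, ∑ ⁅bᵢ, f bᵢ'⁆⁆`. -/
theorem exists_eq_lie_of_traceForm_nondegenerate [CharZero F] [FiniteDimensional F S]
    [FiniteDimensional F M] [Nontrivial S]
    [LieModule.IsIrreducible F S M] (hτ : (LieModule.traceForm F S M).Nondegenerate)
    (f : S →ₗ[F] M) (hf : ∀ x y, f ⁅x, y⁆ = ⁅x, f y⁆ - ⁅y, f x⁆) : ∃ m, ∀ x, f x = ⁅x, m⁆ := by
  classical
  set τ := LieModule.traceForm F S M with hτdef
  have hinv : ∀ x y z, τ ⁅x, y⁆ z = τ x ⁅y, z⁆ := LieModule.traceForm_apply_lie_apply F S M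
  let b := Module.finBasis F S
  set b' := τ.dualBasis hτ b with hb'
  let φ := LieModule.toEnd F S M
  let c : M →ₗ[F] M := ∑ i, φ (b i) * φ (b' i)
  have hcapp : ∀ m, c m = ∑ i, ⁅b i, ⁅b' i, m⁆⁆ := fun m => by simp [c, φ]
  have hcomm : ∀ x m, ⁅x, c m⁆ = c ⁅x, m⁆ := fun x m => by
    have h := sum_lie_dualBasis τ hτ hinv b
      ((LinearMap.mul F (End F M)).compl₁₂ (φ : S →ₗ[F] End F M) (φ : S →ₗ[F] End F M)) x
    have h := congrArg (fun g : End F M => g m) h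
    rw [← Finset.sum_add_distrib] at h
    simp only [LinearMap.compl₁₂_apply, LinearMap.mul_apply', LinearMap.sum_apply,
      LinearMap.add_apply, Module.End.mul_apply, φ, LieHom.coe_toLinearMap,
      LieModule.toEnd_apply_apply, LinearMap.zero_apply, lie_lie, ← hb'] at h
    rw [hcapp, hcapp, lie_sum, ← sub_eq_zero, ← Finset.sum_sub_distrib, ← h]
    refine Finset.sum_congr rfl fun i _ => ?_
    rw [lie_sub]
    abel
  have htr : LinearMap.trace F M c = Module.finrank F S := by
    have : ∀ i, LinearMap.trace F M (φ (b i) * φ (b' i)) = 1 := fun i => by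
      have h := LinearMap.BilinForm.apply_dualBasis_left hτ b i i
      rw [LieModule.traceForm_comm, if_pos rfl] at h
      exact h
    simp [c, this]
  have hc0 : c ≠ 0 := by
    rintro h0
    rw [h0, map_zero] at htr
    exact Module.finrank_pos.ne' (Nat.cast_eq_zero.mp htr.symm)
  let K : LieSubmodule F S M :=
    { LinearMap.ker c with
      lie_mem := fun {x m} hm => by
        change c ⁅x, m⁆ = 0
        rw [← hcomm, show c m = 0 from hm, lie_zero] }
  have hK : K = ⊥ := by
    refine (eq_bot_or_eq_top K).resolve_right fun h => hc0 ?_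
    ext m
    exact (h ▸ LieSubmodule.mem_top m : m ∈ K)
  have hinj : Function.Injective c := by
    rw [← LinearMap.ker_eq_bot, eq_bot_iff]
    intro m hm
    have : m ∈ K := hm
    rw [hK] at this
    exact this
  have hsurj : Function.Surjective c := LinearMap.injective_iff_surjective.mp hinj
  obtain ⟨m, hm⟩ := hsurj (∑ i, ⁅b i, f (b' i)⁆)
  refine ⟨m, fun x => hinj ?_⟩
  rw [← hcomm, hm]
  have h := sum_lie_dualBasis τ hτ hinv b
    ((φ : S →ₗ[F] End F M).compl₂ f) x
  rw [← Finset.sum_add_distrib] at h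
  simp only [LinearMap.compl₂_apply, φ, LieHom.coe_toLinearMap, LieModule.toEnd_apply_apply,
    ← hb', hf, lie_sub, lie_lie] at h
  rw [hcapp, lie_sum, ← sub_eq_zero, ← neg_eq_zero, ← h, ← Finset.sum_sub_distrib,
    ← Finset.sum_neg_distrib]
  refine Finset.sum_congr rfl fun i _ => ?_
  abel

end Casimir

/-! ### Whitehead's first lemma and Weyl's theorem -/

section TraceKer

variable {F S M : Type*} [Field F] [LieRing S] [LieAlgebra F S]
  [AddCommGroup M] [Module F M] [LieRingModule S M] [LieModule F S M]

variable (F S M) in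
/-- The radical of the trace form of a module. -/
noncomputable def traceKer : LieIdeal F S :=
  { LinearMap.ker (LieModule.traceForm F S M) with
    lie_mem := fun {y x} hx => by
      have hx' : LieModule.traceForm F S M x = 0 := hx
      change LieModule.traceForm F S M ⁅y, x⁆ = 0
      ext z
      rw [← lie_skew, map_neg, LinearMap.neg_apply, LieModule.traceForm_apply_lie_apply, hx']
      simp }

theorem mem_traceKer {x : S} :
    x ∈ traceKer F S M ↔ ∀ y, LieModule.traceForm F S M x y = 0 :=
  ⟨fun h y => LinearMap.congr_fun (show LieModule.traceForm F S M x = 0 from h) y,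
    fun h => (LinearMap.ext h : LieModule.traceForm F S M x = 0)⟩

variable (F S) in
/-- The coboundary of an element `m` of a module, as a linear map `x ↦ ⁅x, m⁆`. -/
def coboundary (m : M) : S →ₗ[F] M where
  toFun x := ⁅x, m⁆
  map_add' x y := add_lie x y m
  map_smul' c x := smul_lie c x m

end TraceKer

section Weyl

variable {F S : Type*} [Field F] [CharZero F] [LieRing S] [LieAlgebra F S]
  [FiniteDimensional F S] [LieAlgebra.HasTrivialRadical F S]

/-- The ideal `I ∩ ⁅I, I⁆ᗮ` is abelian, hence zero. -/
theorem lie_self_eq_of_hasTrivialRadical (I : LieIdeal F S) : ⁅I, I⁆ = I := by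
  have hc := LieIdeal.isCompl_killingCompl ⁅I, I⁆
  set K : LieIdeal F S := LieIdeal.killingCompl F S ⁅I, I⁆
  have hle : ⁅I, I⁆ ≤ I := LieSubmodule.lie_le_left I I
  have hab : I ⊓ K = ⊥ := by
    have : IsLieAbelian (I ⊓ K : LieIdeal F S) := by
      rw [LieSubmodule.lie_abelian_iff_lie_self_eq_bot, eq_bot_iff, ← hc.inf_eq_bot]
      exact le_inf (LieSubmodule.mono_lie inf_le_left inf_le_left)
        ((LieSubmodule.lie_le_left _ _).trans inf_le_right)
    exact LieAlgebra.HasTrivialRadical.eq_bot_of_isSolvable _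
  calc ⁅I, I⁆ = ⁅I, I⁆ ⊔ K ⊓ I := by rw [inf_comm, hab, sup_bot_eq]
    _ = (⁅I, I⁆ ⊔ K) ⊓ I := (sup_inf_assoc_of_le K hle).symm
    _ = I := by rw [hc.sup_eq_top, top_inf_eq]

/-- A linear map on `S` vanishing on all brackets is zero, as `S` is perfect. -/
theorem linearMap_eq_zero_of_forall_lie {M : Type*} [AddCommGroup M] [Module F M] (f : S →ₗ[F] M)
    (hf : ∀ x y : S, f ⁅x, y⁆ = 0) : f = 0 := by
  ext x
  have hx : x ∈ (⁅(⊤ : LieIdeal F S), (⊤ : LieIdeal F S)⁆ : LieIdeal F S).toSubmodule := by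
    rw [lie_self_eq_of_hasTrivialRadical]; trivial
  rw [LieSubmodule.lieIdeal_oper_eq_linear_span'] at hx
  induction hx using Submodule.span_induction with
  | mem x h => obtain ⟨a, -, b, -, rfl⟩ := h; exact hf a b
  | zero => simp
  | add a b _ _ ha hb => simp_all
  | smul c a _ ha => simp_all

section Irreducible

variable {M : Type*} [AddCommGroup M] [Module F M] [LieRingModule S M] [LieModule F S M]
  [FiniteDimensional F M]

/-- By Cartan's criterion the radical of the trace form acts nilpotently, hence trivially on an
irreducible module. -/
theorem lie_eq_zero_of_mem_traceKer [LieModule.IsIrreducible F S M] {x : S}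
    (hx : x ∈ traceKer F S M) (m : M) : ⁅x, m⁆ = 0 := by
  have : Nontrivial M := LieModule.nontrivial_of_isIrreducible F S M
  set T := traceKer F S M
  have hder : LieAlgebra.derivedSeries F T 1 = ⊤ := by
    rw [LieIdeal.derivedSeries_eq_derivedSeriesOfIdeal_comap, LieAlgebra.derivedSeriesOfIdeal_succ,
      LieAlgebra.derivedSeriesOfIdeal_zero, lie_self_eq_of_hasTrivialRadical]
    ext y
    simp
  have hnil : LieModule.IsNilpotent (LieAlgebra.derivedSeries F T 1) M := by
    apply LieModule.isNilpotent_derivedSeries_of_traceForm_eq_zero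
    ext a b
    exact mem_traceKer.mp a.2 b
  have hnt := LieModule.nontrivial_max_triv_of_isNilpotent F (LieAlgebra.derivedSeries F T 1) M
  let K : LieSubmodule F S M :=
    { carrier := {m | ∀ y ∈ T, ⁅y, m⁆ = 0}
      add_mem' := fun {a b} ha hb y hy => by rw [lie_add, ha y hy, hb y hy, add_zero]
      zero_mem' := fun y _ => lie_zero y
      smul_mem' := fun c a ha y hy => by rw [lie_smul, ha y hy, smul_zero]
      lie_mem := fun {z a} ha y hy => by
        rw [leibniz_lie, ha y hy, lie_zero, add_zero]
        exact ha _ (lie_mem_left F S T y z hy) }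
  -- Engel's theorem gives a nonzero vector annihilated by `T`
  have hK : K = ⊤ := by
    refine (eq_bot_or_eq_top K).resolve_left fun h => ?_
    obtain ⟨⟨v, hv⟩, hv0⟩ := exists_ne
      (0 : LieModule.maxTrivSubmodule F (LieAlgebra.derivedSeries F T 1) M)
    have : v ∈ K := fun y hy =>
      (LieModule.mem_maxTrivSubmodule F _ M v).mp hv
        ⟨⟨y, hy⟩, hder ▸ LieSubmodule.mem_top (⟨y, hy⟩ : T)⟩
    rw [h] at this
    exact hv0 (Subtype.ext this)
  exact (hK ▸ LieSubmodule.mem_top m : m ∈ K) x hx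

/-- The trace form is nondegenerate on the Killing complement `T'` of its radical `T`, so the
Casimir argument applies to `T'`; a cocycle maps `T` to invariants, hence to zero unless the module
is trivial. -/
theorem exists_eq_lie_of_isIrreducible [LieModule.IsIrreducible F S M]
    (f : S →ₗ[F] M) (hf : ∀ x y, f ⁅x, y⁆ = ⁅x, f y⁆ - ⁅y, f x⁆) : ∃ m, ∀ x, f x = ⁅x, m⁆ := by
  rcases eq_bot_or_eq_top (LieModule.maxTrivSubmodule F S M) with htriv | htriv
  swap
  · have h0 : ∀ (x : S) (m : M), ⁅x, m⁆ = 0 := fun x m =>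
      (LieModule.mem_maxTrivSubmodule F S M m).mp (htriv ▸ LieSubmodule.mem_top m) x
    refine ⟨0, fun x => ?_⟩
    rw [linearMap_eq_zero_of_forall_lie f fun x y => by rw [hf, h0, h0, sub_zero]]
    simp
  set T := traceKer F S M with hT
  have hc := LieIdeal.isCompl_killingCompl T
  set T' : LieIdeal F S := LieIdeal.killingCompl F S T
  have hdec : ∀ x : S, ∃ a ∈ T, ∃ b ∈ T', a + b = x := fun x => by
    rw [← LieSubmodule.mem_sup, hc.sup_eq_top]; trivial
  have hirr : LieModule.IsIrreducible F T' M := by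
    have := LieModule.nontrivial_of_isIrreducible F S M
    refine LieModule.IsIrreducible.mk fun N hN => ?_
    let N' : LieSubmodule F S M :=
      { N.toSubmodule with
        lie_mem := fun {x m} hm => by
          obtain ⟨a, ha, b, hb, rfl⟩ := hdec x
          rw [add_lie, lie_eq_zero_of_mem_traceKer ha, zero_add]
          exact N.lie_mem (x := ⟨b, hb⟩) hm }
    have : N' = ⊤ := (eq_bot_or_eq_top N').resolve_left fun h => hN <| by
      rw [LieSubmodule.eq_bot_iff] at h ⊢
      exact h
    rw [← LieSubmodule.toSubmodule_eq_top] at this ⊢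
    exact this
  have hnt : Nontrivial T' := by
    by_contra h
    rw [not_nontrivial_iff_subsingleton] at h
    have hall : ∀ (x : S) (m : M), ⁅x, m⁆ = 0 := fun x m => by
      obtain ⟨a, ha, b, hb, rfl⟩ := hdec x
      rw [show b = 0 from congrArg Subtype.val (Subsingleton.elim (⟨b, hb⟩ : T') 0), add_zero]
      exact lie_eq_zero_of_mem_traceKer ha m
    have htop : LieModule.maxTrivSubmodule F S M = ⊤ := by
      rw [eq_top_iff]
      exact fun m _ => (LieModule.mem_maxTrivSubmodule F S M m).mpr fun x => hall x m
    exact bot_ne_top (htriv.symm.trans htop)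
  have hnd : (LieModule.traceForm F T' M).Nondegenerate := by
    refine (LieModule.traceForm_isSymm F T' M).isRefl.nondegenerate_iff_separatingLeft.mpr ?_
    rintro ⟨x, hx⟩ h
    have hxT : x ∈ T := mem_traceKer.mpr fun y => by
      obtain ⟨a, ha, b, hb, rfl⟩ := hdec y
      rw [map_add, LieModule.traceForm_comm, mem_traceKer.mp ha, zero_add]
      exact h ⟨b, hb⟩
    have : x ∈ T ⊓ T' := ⟨hxT, hx⟩
    rw [hc.inf_eq_bot] at this
    exact Subtype.ext this
  obtain ⟨m, hm⟩ := exists_eq_lie_of_traceForm_nondegenerate hnd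
    (f ∘ₗ T'.toSubmodule.subtype) (fun x y => hf x y)
  have hfT : ∀ a ∈ T, f a = 0 := fun a ha => by
    have : f a ∈ LieModule.maxTrivSubmodule F S M := by
      rw [LieModule.mem_maxTrivSubmodule]
      intro y
      obtain ⟨t, ht, s, hs, rfl⟩ := hdec y
      rw [add_lie, lie_eq_zero_of_mem_traceKer ht, zero_add]
      have h0 : ⁅a, s⁆ = 0 := by
        have : ⁅a, s⁆ ∈ T ⊓ T' := ⟨lie_mem_left F S T a s ha, lie_mem_right F S T' a s hs⟩
        rw [hc.inf_eq_bot] at this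
        exact this
      have := hf a s
      rw [h0, map_zero, lie_eq_zero_of_mem_traceKer ha, zero_sub, eq_comm, neg_eq_zero] at this
      exact this
    rw [htriv] at this
    exact this
  refine ⟨m, fun x => ?_⟩
  obtain ⟨a, ha, b, hb, rfl⟩ := hdec x
  rw [map_add, hfT a ha, add_lie, lie_eq_zero_of_mem_traceKer ha]
  exact congrArg (0 + ·) (hm ⟨b, hb⟩)

end Irreducible

/-- Whitehead's first lemma: every cocycle of a finite-dimensional module is a coboundary. If `N` is
a proper nonzero submodule, a cocycle is corrected by a coboundary to take values in `N`. -/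
theorem exists_eq_lie_of_cocycle {M : Type*} [AddCommGroup M] [Module F M] [LieRingModule S M]
    [LieModule F S M] [FiniteDimensional F M]
    (f : S →ₗ[F] M) (hf : ∀ x y, f ⁅x, y⁆ = ⁅x, f y⁆ - ⁅y, f x⁆) : ∃ m, ∀ x, f x = ⁅x, m⁆ := by
  induction hn : finrank F M using Nat.strong_induction_on generalizing M with
  | _ n ih =>
    rcases subsingleton_or_nontrivial M with hM | hM
    · exact ⟨0, fun x => Subsingleton.elim _ _⟩
    by_cases hirr : ∀ N : LieSubmodule F S M, N ≠ ⊥ → N = ⊤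
    · have : LieModule.IsIrreducible F S M := LieModule.IsIrreducible.mk hirr
      exact exists_eq_lie_of_isIrreducible f hf
    push Not at hirr
    obtain ⟨N, hN0, hN1⟩ := hirr
    have hlt : finrank F N < n := by
      rw [← hn]
      apply Submodule.finrank_lt
      exact fun h => hN1 (by rwa [LieSubmodule.toSubmodule_eq_top] at h)
    have hpos : 0 < finrank F N := by
      have : Nontrivial N := (LieSubmodule.nontrivial_iff_ne_bot F S M).mpr hN0
      exact Module.finrank_pos
    have hltq : finrank F (M ⧸ N) < n := by
      have : finrank F (M ⧸ N) + finrank F N = finrank F M :=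
        Submodule.finrank_quotient_add_finrank N.toSubmodule
      omega
    have : FiniteDimensional F (M ⧸ N) :=
      inferInstanceAs (FiniteDimensional F (M ⧸ N.toSubmodule))
    obtain ⟨mq, hmq⟩ := ih _ hltq (M := M ⧸ N)
      ((LieSubmodule.Quotient.mk' N : M →ₗ[F] M ⧸ N) ∘ₗ f) (fun x y => by
        simp only [LinearMap.comp_apply, hf, map_sub]
        simp only [LieModuleHom.coe_toLinearMap, LieModuleHom.map_lie]) rfl
    obtain ⟨m, rfl⟩ := LieSubmodule.Quotient.surjective_mk' N mq
    have hmem : ∀ x, (f - coboundary F S m) x ∈ N.toSubmodule := by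
      intro x
      have h := hmq x
      rw [← LieModuleHom.map_lie] at h
      have h2 : LieSubmodule.Quotient.mk' N (f x - ⁅x, m⁆) = 0 := by
        rw [map_sub, sub_eq_zero]; exact h
      exact (LieSubmodule.Quotient.mk_eq_zero (N := N)).mp h2
    obtain ⟨n0, hn0⟩ := ih _ hlt (M := N)
      (LinearMap.codRestrict N.toSubmodule _ hmem) (fun x y => by
        apply Subtype.ext
        change f ⁅x, y⁆ - ⁅⁅x, y⁆, m⁆ = ⁅x, f y - ⁅y, m⁆⁆ - ⁅y, f x - ⁅x, m⁆⁆
        rw [hf, lie_lie, lie_sub, lie_sub]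
        abel) rfl
    refine ⟨m + n0, fun x => ?_⟩
    have h : f x - ⁅x, m⁆ = ⁅x, (n0 : M)⁆ := congrArg Subtype.val (hn0 x)
    rw [lie_add, ← h]
    abel

/-- Weyl's theorem: the finite-dimensional modules of a Lie algebra with trivial radical in
characteristic zero are completely reducible. A linear projection `p` onto a submodule `N` is
corrected to an equivariant one by Whitehead's lemma for the cocycle `x ↦ ⁅x, p⁆` in
`Hom (M / N, N)`. -/
theorem complementedLattice_lieSubmodule (M : Type*) [AddCommGroup M] [Module F M]
    [LieRingModule S M] [LieModule F S M] [FiniteDimensional F M] :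
    ComplementedLattice (LieSubmodule F S M) := by
  refine ⟨fun N => ?_⟩
  let V : LieSubmodule F S (M →ₗ[F] M) :=
    { carrier := {φ | (∀ n ∈ N, φ n = 0) ∧ ∀ m, φ m ∈ N}
      add_mem' := fun {a b} ha hb =>
        ⟨fun n hn => by simp [ha.1 n hn, hb.1 n hn], fun m => add_mem (ha.2 m) (hb.2 m)⟩
      zero_mem' := ⟨fun n _ => rfl, fun m => zero_mem N⟩
      smul_mem' := fun c a ha =>
        ⟨fun n hn => by simp [ha.1 n hn], fun m => N.smul_mem c (ha.2 m)⟩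
      lie_mem := fun {x a} ha =>
        ⟨fun n hn => by simp [ha.1 n hn, ha.1 _ (N.lie_mem hn)],
          fun m => by
            rw [LieHom.lie_apply]
            exact sub_mem (N.lie_mem (ha.2 m)) (ha.2 _)⟩ }
  obtain ⟨p0, hp0⟩ := LinearMap.exists_leftInverse_of_injective N.toSubmodule.subtype
    (Submodule.ker_subtype _)
  let p : M →ₗ[F] M := N.toSubmodule.subtype ∘ₗ p0
  have hp1 : ∀ n ∈ N, p n = n := fun n hn =>
    congrArg Subtype.val (LinearMap.congr_fun hp0 (⟨n, hn⟩ : N))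
  have hp2 : ∀ m, p m ∈ N := fun m => (p0 m).2
  have hmem : ∀ x : S, coboundary F S p x ∈ V.toSubmodule := fun x =>
    ⟨fun n hn => by
        change ⁅x, p n⁆ - p ⁅x, n⁆ = 0
        rw [hp1 n hn, hp1 _ (N.lie_mem hn), sub_self],
      fun m => sub_mem (N.lie_mem (hp2 m)) (hp2 _)⟩
  obtain ⟨⟨φ, hφ⟩, h⟩ := exists_eq_lie_of_cocycle (M := V)
    (LinearMap.codRestrict V.toSubmodule _ hmem)
    (fun x y => Subtype.ext (lie_lie x y p))
  have hq : ∀ (x : S) m, ⁅x, (p - φ) m⁆ = (p - φ) ⁅x, m⁆ := fun x m => by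
    have h1 : ⁅x, p m⁆ - p ⁅x, m⁆ = ⁅x, φ m⁆ - φ ⁅x, m⁆ :=
      LinearMap.congr_fun (congrArg Subtype.val (h x)) m
    simp only [LinearMap.sub_apply, lie_sub]
    rw [sub_eq_sub_iff_sub_eq_sub, h1]
  let K : LieSubmodule F S M :=
    { LinearMap.ker (p - φ) with
      lie_mem := fun {x m} hm => by
        change (p - φ) ⁅x, m⁆ = 0
        rw [← hq, show (p - φ) m = 0 from hm, lie_zero] }
  refine ⟨K, ?_, ?_⟩
  · rw [disjoint_iff, LieSubmodule.eq_bot_iff]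
    rintro m ⟨hm, hm'⟩
    have : (p - φ) m = 0 := hm'
    rwa [LinearMap.sub_apply, hp1 m hm, hφ.1 m hm, sub_zero] at this
  · rw [codisjoint_iff, eq_top_iff]
    intro m _
    rw [LieSubmodule.mem_sup]
    refine ⟨(p - φ) m, sub_mem (hp2 m) (hφ.2 m), m - (p - φ) m, ?_, by abel⟩
    change (p - φ) _ = 0
    have hN : (p - φ) m ∈ N := sub_mem (hp2 m) (hφ.2 m)
    have : (p - φ) ((p - φ) m) = (p - φ) m := by
      conv_lhs => rw [LinearMap.sub_apply, hp1 _ hN, hφ.1 _ hN, sub_zero]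
    rw [map_sub, this, sub_self]

end Weyl

/-! ### Nilpotency of `[L, I]` for a solvable ideal `I` -/

section Nilpotent

open TensorProduct

theorem trace_toEnd_eq_zero_of_mem_lie {K L : Type*} [Field K] [LieRing L] [LieAlgebra K L]
    (M : Type*) [AddCommGroup M] [Module K M] [LieRingModule L M] [LieModule K L M]
    {I J : LieIdeal K L} {x : L} (hx : x ∈ ⁅I, J⁆) :
    LinearMap.trace K M (LieModule.toEnd K L M x) = 0 := by
  replace hx : x ∈ (⁅I, J⁆ : LieIdeal K L).toSubmodule := hx
  rw [LieSubmodule.lieIdeal_oper_eq_linear_span'] at hx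
  induction hx using Submodule.span_induction with
  | mem x h => obtain ⟨a, -, b, -, rfl⟩ := h; simp
  | zero => simp
  | add a b _ _ ha hb => simp [ha, hb]
  | smul c a _ ha => simp [ha]

/-- Over an algebraically closed field, a weight space of a solvable ideal `I` is a submodule on
which `I` acts by scalars; brackets have trace zero, so `⁅L, I⁆` acts on it by zero. -/
theorem isNilpotent_toEnd_of_mem_lie_of_isAlgClosed {K L M : Type*} [Field K] [CharZero K]
    [IsAlgClosed K] [LieRing L] [LieAlgebra K L]
    (I : LieIdeal K L) [LieAlgebra.IsSolvable I] [AddCommGroup M] [Module K M] [LieRingModule L M]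
    [LieModule K L M] [FiniteDimensional K M] {x : L} (hx : x ∈ ⁅(⊤ : LieIdeal K L), I⁆) :
    IsNilpotent (LieModule.toEnd K L M x) := by
  induction hn : finrank K M using Nat.strong_induction_on generalizing M with
  | _ n ih =>
    rcases subsingleton_or_nontrivial M with hM | hM
    · exact ⟨1, LinearMap.ext fun m => Subsingleton.elim _ _⟩
    obtain ⟨χ, hχ⟩ := LieModule.exists_nontrivial_weightSpace_of_isSolvable K I M
    let N : LieSubmodule K L M := LieModule.weightSpaceOfIsLieTower K M χ
    have hN : ∀ m ∈ N, ∀ y (hy : y ∈ I), ⁅y, m⁆ = χ ⟨y, hy⟩ • m := fun m hm y hy => by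
      have h : m ∈ LieModule.weightSpace M χ := hm
      exact (LieModule.mem_weightSpace _ _).mp h ⟨y, hy⟩
    have hNnt : Nontrivial N := hχ
    have hxI : x ∈ I := LieSubmodule.lie_le_right _ _ hx
    have htr0 : LinearMap.trace K N (LieModule.toEnd K L N x) = 0 :=
      trace_toEnd_eq_zero_of_mem_lie N hx
    have hχx : χ ⟨x, hxI⟩ = 0 := by
      have h : LieModule.toEnd K L N x = χ ⟨x, hxI⟩ • LinearMap.id :=
        LinearMap.ext fun m => Subtype.ext (hN m m.2 x hxI)
      rw [h, map_smul, LinearMap.trace_id, smul_eq_mul] at htr0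
      exact (mul_eq_zero.mp htr0).resolve_right (Nat.cast_ne_zero.mpr finrank_pos.ne')
    have hltq : finrank K (M ⧸ N) < n := by
      have : finrank K (M ⧸ N) + finrank K N = finrank K M :=
        Submodule.finrank_quotient_add_finrank N.toSubmodule
      have : 0 < finrank K N := finrank_pos
      omega
    have : FiniteDimensional K (M ⧸ N) :=
      inferInstanceAs (FiniteDimensional K (M ⧸ N.toSubmodule))
    obtain ⟨k, hk⟩ := ih _ hltq (M := M ⧸ N) rfl
    have hpow : ∀ j m, ((LieModule.toEnd K L (M ⧸ N) x) ^ j) (LieSubmodule.Quotient.mk' N m) =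
        LieSubmodule.Quotient.mk' N (((LieModule.toEnd K L M x) ^ j) m) := fun j m => by
      induction j with
      | zero => rfl
      | succ j ihj =>
        rw [pow_succ', pow_succ', Module.End.mul_apply, Module.End.mul_apply, ihj]
        exact (LieModuleHom.map_lie (LieSubmodule.Quotient.mk' N) x _).symm
    refine ⟨k + 1, LinearMap.ext fun m => ?_⟩
    have hmem : ((LieModule.toEnd K L M x) ^ k) m ∈ N := by
      have := hpow k m
      rw [hk, LinearMap.zero_apply, eq_comm] at this
      exact (LieSubmodule.Quotient.mk_eq_zero (N := N)).mp this
    rw [pow_succ', Module.End.mul_apply, LieModule.toEnd_apply_apply, hN _ hmem x hxI, hχx,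
      zero_smul, LinearMap.zero_apply]

variable {F L : Type*} [Field F] [CharZero F] [LieRing L] [LieAlgebra F L]

/-- The case of an algebraically closed field, applied after extending scalars. -/
theorem isNilpotent_toEnd_of_mem_lie (M : Type*) [AddCommGroup M] [Module F M] [LieRingModule L M]
    [LieModule F L M] [FiniteDimensional F M] (I : LieIdeal F L) [hI : LieAlgebra.IsSolvable I]
    {x : L} (hx : x ∈ ⁅(⊤ : LieIdeal F L), I⁆) : IsNilpotent (LieModule.toEnd F L M x) := by
  let A := AlgebraicClosure F
  have hsol : LieAlgebra.IsSolvable (I.baseChange A : LieIdeal A (A ⊗[F] L)) := by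
    obtain ⟨k, hk⟩ := LieAlgebra.IsSolvable.solvable F I
    rw [LieIdeal.derivedSeries_eq_bot_iff] at hk
    refine LieAlgebra.IsSolvable.mk (R := A) (k := k)
      ((LieIdeal.derivedSeries_eq_bot_iff _ _).mpr ?_)
    rw [LieAlgebra.derivedSeriesOfIdeal_baseChange, hk, LieSubmodule.baseChange_bot]
  have hx' : (1 : A) ⊗ₜ[F] x ∈ ⁅(⊤ : LieIdeal A (A ⊗[F] L)), I.baseChange A⁆ := by
    rw [← LieSubmodule.baseChange_top, ← LieSubmodule.lie_baseChange]
    exact Submodule.tmul_mem_baseChange_of_mem 1 hx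
  have h := isNilpotent_toEnd_of_mem_lie_of_isAlgClosed (M := A ⊗[F] M) (I.baseChange A) hx'
  have hbc_inj : Function.Injective (End.baseChangeHom F A M) :=
    LinearMap.baseChangeHom_injective F M A
  rw [← IsNilpotent.map_iff hbc_inj]
  rwa [LieModule.toEnd_baseChange] at h

theorem isNilpotent_lie_top_of_isSolvable [FiniteDimensional F L] (I : LieIdeal F L)
    [LieAlgebra.IsSolvable I] : LieRing.IsNilpotent (⁅(⊤ : LieIdeal F L), I⁆ : LieIdeal F L) := by
  rw [LieAlgebra.isNilpotent_iff_forall (R := F)]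
  rintro ⟨x, hx⟩
  exact LieSubalgebra.isNilpotent_ad_of_isNilpotent_ad
    (K := ((⁅(⊤ : LieIdeal F L), I⁆ : LieIdeal F L) : LieSubalgebra F L)) (x := ⟨x, hx⟩)
    (isNilpotent_toEnd_of_mem_lie L I hx)

end Nilpotent

/-! ### The Jacobson radical, the derived ideal and the Levi decomposition -/

open LieAlgebra

section Structure

variable {F L : Type*} [Field F] [LieRing L] [LieAlgebra F L]

/-- An ideal of `L`, regarded as an `ad S`-submodule of `L`. -/
def restrictTo (S : LieSubalgebra F L) (I : LieIdeal F L) : LieSubmodule F S L :=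
  { I.toSubmodule with lie_mem := fun {_ _} hm => I.lie_mem hm }

theorem mem_restrictTo {S : LieSubalgebra F L} {I : LieIdeal F L} {x : L} :
    x ∈ restrictTo S I ↔ x ∈ I := Iff.rfl

theorem lie_lieIdeal_induction {I J : LieIdeal F L} {V : Submodule F L}
    (h : ∀ x ∈ I, ∀ y ∈ J, ⁅x, y⁆ ∈ V) {z : L} (hz : z ∈ ⁅I, J⁆) : z ∈ V := by
  replace hz : z ∈ (⁅I, J⁆ : LieIdeal F L).toSubmodule := hz
  rw [LieSubmodule.lieIdeal_oper_eq_linear_span'] at hz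
  refine Submodule.span_le.mpr ?_ hz
  rintro _ ⟨x, hx, y, hy, rfl⟩
  exact h x hx y hy

theorem IsLeviFactor.exists_add {S : LieSubalgebra F L} (hS : IsLeviFactor S) (x : L) :
    ∃ s ∈ S, ∃ r ∈ radical F L, s + r = x := by
  have : x ∈ S.toSubmodule ⊔ (radical F L).toSubmodule := by
    rw [hS.2.sup_eq_top]; trivial
  exact Submodule.mem_sup.mp this

/-- An `ad S`-submodule that is stable under the radical is an ideal. -/
def IsLeviFactor.toIdeal {S : LieSubalgebra F L} (hS : IsLeviFactor S) (U : LieSubmodule F S L)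
    (hU : ∀ r ∈ radical F L, ∀ u ∈ U, ⁅r, u⁆ ∈ U) : LieIdeal F L :=
  { U.toSubmodule with
    lie_mem := fun {x m} hm => by
      obtain ⟨s, hs, r, hr, rfl⟩ := hS.exists_add x
      rw [add_lie]
      exact add_mem (U.lie_mem (x := ⟨s, hs⟩) hm) (hU r hr m hm) }

/-- An ideal that covers `L` modulo the radical and modulo `L²` is everything: the quotient is
solvable and perfect. -/
theorem eq_top_of_sup_radical_of_sup_derived [IsNoetherian F L] {M : LieIdeal F L}
    (h1 : M ⊔ radical F L = ⊤) (h2 : M ⊔ derived F L = ⊤) : M = ⊤ := by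
  have key : ∀ k, M ⊔ derivedSeriesOfIdeal F L k (radical F L) = ⊤ := fun k => by
    induction k with
    | zero => exact h1
    | succ k ih =>
      rw [derivedSeriesOfIdeal_succ, eq_top_iff]
      set D := derivedSeriesOfIdeal F L k (radical F L)
      have h3 : M ⊔ ⁅M ⊔ D, M ⊔ D⁆ = ⊤ := by rw [ih]; exact h2
      rw [← h3, LieSubmodule.sup_lie, LieSubmodule.lie_sup M D D]
      refine sup_le le_sup_left (sup_le ((LieSubmodule.lie_le_left _ _).trans le_sup_left)
        (sup_le ((LieSubmodule.lie_le_right _ _).trans le_sup_left) le_sup_right))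
  obtain ⟨k, hk⟩ := IsSolvable.solvable F (radical F L)
  rw [LieIdeal.derivedSeries_eq_bot_iff] at hk
  have := key k
  rwa [hk, sup_bot_eq] at this

theorem le_radical_of_isNilpotent [IsNoetherian F L] {K : LieIdeal F L}
    (hK : LieRing.IsNilpotent K) : K ≤ radical F L :=
  (LieIdeal.solvable_iff_le_radical F L K).mp inferInstance

theorem nilradical_le_radical [IsNoetherian F L] : nilradical F L ≤ radical F L :=
  sSup_le fun _ hK => le_radical_of_isNilpotent hK

/-- If every subspace between `A` and `B` is an ideal and there are only finitely many ideals,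
then `B` is at most one dimension larger than `A`: if `a` and `b` are independent modulo `A`, the
subspaces `A + F (a + t b)` for `t` in `F` are pairwise distinct. -/
theorem sup_span_eq_of_finite [CharZero F] [Finite (LieIdeal F L)] {A B : Submodule F L}
    (h : ∀ U : Submodule F L, A ≤ U → U ≤ B → ∃ I : LieIdeal F L, I.toSubmodule = U)
    (hAB : A ≤ B) {a : L} (haB : a ∈ B) (haA : a ∉ A) : A ⊔ F ∙ a = B := by
  refine le_antisymm (sup_le hAB (by simpa using haB)) fun b hb => ?_
  by_contra hba
  have hle : ∀ t : F, A ⊔ F ∙ (a + t • b) ≤ B := fun t =>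
    sup_le hAB (by simpa using add_mem haB (B.smul_mem t hb))
  choose g hg using fun t : F => h (A ⊔ F ∙ (a + t • b)) le_sup_left (hle t)
  refine not_injective_infinite_finite g fun t u htu => ?_
  by_contra hne
  have heq : A ⊔ F ∙ (a + t • b) = A ⊔ F ∙ (a + u • b) := by rw [← hg, ← hg, htu]
  have hmem : a + t • b ∈ A ⊔ F ∙ (a + u • b) :=
    heq ▸ Submodule.mem_sup_right (Submodule.mem_span_singleton_self _)
  obtain ⟨x, hx, y, hy, hxy⟩ := Submodule.mem_sup.mp hmem
  obtain ⟨c, rfl⟩ := Submodule.mem_span_singleton.mp hy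
  -- `x + c (a + u b) = a + t b`, so that `(t - c u) b ∈ A + F a`
  have h1 : (t - c * u) • b = x + (c - 1) • a := by
    have : x + (c • a + (c * u) • b) = a + t • b := by rw [← hxy, smul_add, smul_smul]
    rw [sub_smul, sub_smul, one_smul, sub_eq_iff_eq_add]
    rw [← add_right_inj a, ← this]; abel
  by_cases h0 : t - c * u = 0
  · rw [h0, zero_smul] at h1
    by_cases hc : c - 1 = 0
    · apply hne
      rw [sub_eq_zero] at hc h0
      rw [h0, hc, one_mul]
    · refine haA ((A.smul_mem_iff hc).mp ?_)
      rw [eq_neg_of_add_eq_zero_right h1.symm]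
      exact neg_mem hx
  · refine hba ((Submodule.smul_mem_iff _ h0).mp ?_)
    rw [h1]
    exact add_mem (Submodule.mem_sup_left hx)
      (Submodule.mem_sup_right (Submodule.smul_mem _ _ (Submodule.mem_span_singleton_self a)))

theorem derived_sup_span_eq_top [CharZero F] [Finite (LieIdeal F L)] {a : L}
    (ha : a ∉ derived F L) : (derived F L).toSubmodule ⊔ F ∙ a = ⊤ :=
  sup_span_eq_of_finite (fun U hU _ =>
    ⟨{ U with
      lie_mem := fun {_ _} _ => hU (LieSubmodule.lie_mem_lie (I := (⊤ : LieIdeal F L))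
        (N := (⊤ : LieIdeal F L)) trivial trivial) }, rfl⟩) le_top trivial ha

theorem center_eq_span [CharZero F] [Finite (LieIdeal F L)] {z : L} (hz : z ∈ center F L)
    (hz0 : z ≠ 0) : (center F L).toSubmodule = F ∙ z := by
  rw [← sup_span_eq_of_finite (A := ⊥) (B := (center F L).toSubmodule) (fun U _ hU =>
    ⟨{ U with
      lie_mem := fun {x m} hm => by
        rw [(LieModule.mem_maxTrivSubmodule F L L m).mp (hU hm) x]
        exact U.zero_mem }, rfl⟩) bot_le hz (by simpa using hz0), bot_sup_eq]

theorem disjoint_span_singleton_of_notMem {A : Submodule F L} {a : L} (ha : a ∉ A) :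
    Disjoint A (F ∙ a) := by
  rw [Submodule.disjoint_span_singleton']
  · exact ha
  · rintro rfl
    exact ha A.zero_mem

theorem lie_mem_derived (x y : L) : ⁅x, y⁆ ∈ derived F L :=
  LieSubmodule.lie_mem_lie (LieSubmodule.mem_top x) (LieSubmodule.mem_top y)

/-- A maximal ideal `M` contains `L²` or the radical, as `L / M` is not both perfect and
solvable. -/
theorem lie_radical_le_of_isCoatom [IsNoetherian F L] {M : LieIdeal F L} (hM : IsCoatom M) :
    ⁅(⊤ : LieIdeal F L), radical F L⁆ ≤ M := by
  by_cases hR : radical F L ≤ M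
  · exact (LieSubmodule.lie_le_right _ _).trans hR
  have h1 : M ⊔ radical F L = ⊤ := hM.2 _ (left_lt_sup.mpr hR)
  by_contra h
  have h2 : ¬ derived F L ≤ M := fun h' => h ((LieSubmodule.mono_lie le_rfl le_top).trans h')
  exact hM.1 (eq_top_of_sup_radical_of_sup_derived h1 (hM.2 _ (left_lt_sup.mpr h2)))

variable [CharZero F] [FiniteDimensional F L] {S : LieSubalgebra F L}

theorem IsLeviFactor.complementedLattice (hS : IsLeviFactor S) :
    ComplementedLattice (LieSubmodule F S L) :=
  have := hS.1
  complementedLattice_lieSubmodule L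

theorem IsLeviFactor.isCoatomistic (hS : IsLeviFactor S) :
    IsCoatomistic (LieSubmodule F S L) := by
  have := hS.complementedLattice
  have : WellFoundedLT (LieSubmodule F S L) := LieSubmodule.wellFoundedLT_of_isArtinian F S L
  have : IsCompactlyGenerated (LieSubmodule F S L)ᵒᵈ :=
    CompleteLattice.isCompactlyGenerated_of_wellFoundedGT
  rw [← isAtomistic_dual_iff_isCoatomistic]
  infer_instance

/-- The `ad S`-submodules above `[L, Rad(L)]` are ideals, so that by complete reducibility
`[L, Rad(L)]` is an intersection of maximal ideals. -/
theorem IsLeviFactor.jacobson_eq (hS : IsLeviFactor S) :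
    jacobson F L = ⁅(⊤ : LieIdeal F L), radical F L⁆ := by
  refine le_antisymm (fun x hx => ?_) (le_sInf fun M hM => lie_radical_le_of_isCoatom hM)
  have := hS.isCoatomistic
  set P : LieIdeal F L := ⁅(⊤ : LieIdeal F L), radical F L⁆ with hP
  obtain ⟨s, hs, hsU⟩ := eq_sInf_coatoms (restrictTo S P)
  rw [← mem_restrictTo (S := S), hs, ← SetLike.mem_coe, LieSubmodule.coe_sInf,
    Set.mem_iInter₂]
  intro U hUs
  have hU := hsU U hUs
  have hPU : restrictTo S P ≤ U := hs.le.trans (sInf_le hUs)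
  have hPI : ∀ u ∈ P, u ∈ U := fun u hu => hPU hu
  have hUr : ∀ y, ∀ r ∈ radical F L, ⁅y, r⁆ ∈ U := fun y r hr =>
    hPI _ (LieSubmodule.lie_mem_lie (LieSubmodule.mem_top y) hr)
  let I := hS.toIdeal U fun r hr u _ => by
    rw [← lie_skew]
    exact neg_mem (hUr u r hr)
  have hI : IsCoatom I := by
    refine ⟨fun h => hU.1 ?_, fun K hK => ?_⟩
    · rw [eq_top_iff]
      exact fun y _ => (h ▸ LieSubmodule.mem_top y : y ∈ I)
    · have h1 : restrictTo S K = ⊤ := hU.2 _ <| by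
        refine lt_of_le_of_ne (fun y hy => hK.le hy) fun h => hK.ne ?_
        ext y
        rw [← mem_restrictTo (S := S) (I := K), ← h]
        rfl
      rw [eq_top_iff]
      exact fun y _ => (h1 ▸ LieSubmodule.mem_top y : y ∈ restrictTo S K)
  exact (sInf_le hI : jacobson F L ≤ I) hx

theorem IsLeviFactor.lie_mem_jacobson (hS : IsLeviFactor S) (x : L) {r : L}
    (hr : r ∈ radical F L) : ⁅x, r⁆ ∈ jacobson F L := by
  rw [hS.jacobson_eq]
  exact LieSubmodule.lie_mem_lie (LieSubmodule.mem_top x) hr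

theorem IsLeviFactor.jacobson_le_nilradical (hS : IsLeviFactor S) :
    jacobson F L ≤ nilradical F L := by
  rw [hS.jacobson_eq]
  exact le_sSup (isNilpotent_lie_top_of_isSolvable (radical F L))

theorem IsLeviFactor.jacobson_le_radical (hS : IsLeviFactor S) : jacobson F L ≤ radical F L :=
  hS.jacobson_le_nilradical.trans nilradical_le_radical

theorem IsLeviFactor.le_derived (hS : IsLeviFactor S) :
    S.toSubmodule ≤ (derived F L).toSubmodule := fun s hs => by
  have := hS.1
  have h := linearMap_eq_zero_of_forall_lie (F := F) (S := S)
    ((derived F L).toSubmodule.mkQ ∘ₗ S.toSubmodule.subtype) fun x y =>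
      (Submodule.Quotient.mk_eq_zero _).mpr (lie_mem_derived (F := F) (x : L) (y : L))
  exact (Submodule.Quotient.mk_eq_zero _).mp (LinearMap.congr_fun h (⟨s, hs⟩ : S))

/-- `L² = S + J(L)`, since `S` is perfect and `J(L) = [L, Rad(L)]`. -/
theorem IsLeviFactor.derived_eq (hS : IsLeviFactor S) :
    (derived F L).toSubmodule = S.toSubmodule ⊔ (jacobson F L).toSubmodule := by
  refine le_antisymm (fun z hz => lie_lieIdeal_induction (fun x _ y _ => ?_) hz)
    (sup_le hS.le_derived ?_)
  · obtain ⟨s, hs, r, hr, rfl⟩ := hS.exists_add x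
    obtain ⟨s', hs', r', hr', rfl⟩ := hS.exists_add y
    have h1 : ⁅r, s'⁆ ∈ jacobson F L := by
      rw [← lie_skew]; exact neg_mem (hS.lie_mem_jacobson _ hr)
    rw [lie_add, add_lie, add_assoc]
    exact add_mem (Submodule.mem_sup_left (S.lie_mem hs hs')) (Submodule.mem_sup_right
      (add_mem h1 (hS.lie_mem_jacobson _ hr')))
  · rw [hS.jacobson_eq]
    exact LieSubmodule.mono_lie le_rfl le_top

theorem IsLeviFactor.jacobson_le_derived (hS : IsLeviFactor S) : jacobson F L ≤ derived F L := by
  rw [hS.jacobson_eq]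
  exact LieSubmodule.mono_lie le_rfl le_top

theorem IsLeviFactor.derived_inf_radical (hS : IsLeviFactor S) :
    derived F L ⊓ radical F L = jacobson F L := by
  rw [← LieSubmodule.toSubmodule_inj, LieSubmodule.inf_toSubmodule, hS.derived_eq, sup_comm,
    sup_inf_assoc_of_le _ (LieSubmodule.toSubmodule_le_toSubmodule _ _ |>.mpr
      hS.jacobson_le_radical), hS.2.inf_eq_bot, sup_bot_eq]

end Structure

/-! ### Centres, centralizers and `Z(Nil(L))` -/

section Centre

variable {F L : Type*} [Field F] [LieRing L] [LieAlgebra F L]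

/-- The centralizer of an ideal, as an ideal. -/
def centralizerIdeal (I : LieIdeal F L) : LieIdeal F L :=
  { centralizer I with
    lie_mem := fun {x m} hm y hy => by
      have h1 : ⁅m, y⁆ = 0 := hm y hy
      have h2 : ⁅m, ⁅x, y⁆⁆ = 0 := hm _ (lie_mem_right F L I x y hy)
      rw [lie_lie, h1, h2, lie_zero, sub_zero] }

theorem mem_centralizer {I : LieIdeal F L} {x : L} :
    x ∈ centralizer I ↔ ∀ y ∈ I, ⁅x, y⁆ = 0 := Iff.rfl

variable (F L) in
/-- `Z(Nil(L))` as an ideal. -/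
def nilCenterIdeal : LieIdeal F L := nilradical F L ⊓ centralizerIdeal (nilradical F L)

theorem mem_center {x : L} : x ∈ center F L ↔ ∀ y : L, ⁅y, x⁆ = 0 :=
  LieModule.mem_maxTrivSubmodule F L L x

theorem lie_eq_zero_of_mem_center {x : L} (hx : x ∈ center F L) (y : L) : ⁅x, y⁆ = 0 := by
  rw [← lie_skew, mem_center.mp hx, neg_zero]

theorem isNilpotent_of_lie_self_eq_bot {I : LieIdeal F L} (h : ⁅I, I⁆ = ⊥) :
    LieRing.IsNilpotent I := by
  have : IsLieAbelian I := (LieSubmodule.lie_abelian_iff_lie_self_eq_bot I).mpr h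
  infer_instance

theorem center_le_nilradical : center F L ≤ nilradical F L := by
  refine le_sSup (isNilpotent_of_lie_self_eq_bot ?_)
  rw [LieSubmodule.lie_eq_bot_iff]
  exact fun x _ y hy => mem_center.mp hy x

theorem center_le_nilCenterTriv (S : LieSubalgebra F L) :
    (center F L).toSubmodule ≤ nilCenterTriv S := fun _ hx =>
  ⟨⟨center_le_nilradical hx, fun y _ => lie_eq_zero_of_mem_center hx y⟩,
    fun s _ => mem_center.mp hx s⟩

/-- The copy inside `L` of an ideal `K` of `L²`, an ideal of `L` if `L = L² + F z` with `z`
central. -/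
def idealOfDerivedIdeal {z : L} (hz : z ∈ center F L)
    (htop : (derived F L).toSubmodule ⊔ F ∙ z = ⊤) (K : LieIdeal F (derived F L)) :
    LieIdeal F L :=
  { K.toSubmodule.map (derived F L).toSubmodule.subtype with
    lie_mem := fun {x _} hm => by
      obtain ⟨k, hk, rfl⟩ := hm
      obtain ⟨d, hd, y, hy, rfl⟩ := Submodule.mem_sup.mp (htop ▸ Submodule.mem_top : x ∈ _)
      obtain ⟨c, rfl⟩ := Submodule.mem_span_singleton.mp hy
      refine ⟨⁅(⟨d, hd⟩ : derived F L), k⁆, K.lie_mem hk, ?_⟩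
      rw [add_lie, smul_lie, lie_eq_zero_of_mem_center hz, smul_zero, add_zero]
      rfl }

theorem finite_lieIdeal_derived [Finite (LieIdeal F L)] {z : L} (hz : z ∈ center F L)
    (htop : (derived F L).toSubmodule ⊔ F ∙ z = ⊤) : Finite (LieIdeal F (derived F L)) := by
  refine Finite.of_injective (idealOfDerivedIdeal hz htop) fun K K' h => ?_
  rw [← LieSubmodule.toSubmodule_inj] at h ⊢
  exact Submodule.map_injective_of_injective (Submodule.subtype_injective _) h

theorem derived_derived_eq_top {z : L} (hz : z ∈ center F L)
    (htop : (derived F L).toSubmodule ⊔ F ∙ z = ⊤) : derived F (derived F L) = ⊤ := by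
  have hdec : ∀ x : L, ∃ d : derived F L, ∃ c : F, x = d + c • z := fun x => by
    obtain ⟨d, hd, y, hy, rfl⟩ := Submodule.mem_sup.mp (htop ▸ Submodule.mem_top : x ∈ _)
    obtain ⟨c, rfl⟩ := Submodule.mem_span_singleton.mp hy
    exact ⟨⟨d, hd⟩, c, rfl⟩
  have key : ∀ x ∈ derived F L, x ∈
      (derived F (derived F L)).toSubmodule.map (derived F L).toSubmodule.subtype := by
    intro x hx
    refine lie_lieIdeal_induction (fun u _ v _ => ?_) hx
    obtain ⟨d, c, rfl⟩ := hdec u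
    obtain ⟨d', c', rfl⟩ := hdec v
    refine ⟨⁅d, d'⁆, lie_mem_derived d d', ?_⟩
    simp only [add_lie, lie_add, smul_lie, lie_smul, lie_eq_zero_of_mem_center hz,
      mem_center.mp hz, smul_zero, add_zero]
    rfl
  rw [eq_top_iff]
  rintro ⟨x, hx⟩ -
  obtain ⟨y, hy, hyx⟩ := key x hx
  rwa [← show y = ⟨x, hx⟩ from Subtype.ext hyx]

theorem lie_derived_eq_of_sup_span_eq_top {a : L}
    (h : (derived F L).toSubmodule ⊔ F ∙ a = ⊤) :
    ⁅(⊤ : LieIdeal F L), derived F L⁆ = derived F L := by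
  refine le_antisymm (LieSubmodule.lie_le_right _ _) fun z hz => ?_
  refine lie_lieIdeal_induction
    (V := (⁅(⊤ : LieIdeal F L), derived F L⁆ : LieIdeal F L).toSubmodule)
    (fun x _ y _ => ?_) hz
  have hl : ∀ x : L, ∀ d ∈ derived F L, ⁅x, d⁆ ∈ ⁅(⊤ : LieIdeal F L), derived F L⁆ :=
    fun x d hd => LieSubmodule.lie_mem_lie (LieSubmodule.mem_top x) hd
  obtain ⟨d, hd, u, hu, rfl⟩ := Submodule.mem_sup.mp (h ▸ Submodule.mem_top : x ∈ _)
  obtain ⟨c, rfl⟩ := Submodule.mem_span_singleton.mp hu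
  obtain ⟨d', hd', u', hu', rfl⟩ := Submodule.mem_sup.mp (h ▸ Submodule.mem_top : y ∈ _)
  obtain ⟨c', rfl⟩ := Submodule.mem_span_singleton.mp hu'
  rw [lie_add, add_lie d _ (c' • a)]
  refine add_mem (hl _ d' hd') (add_mem ?_ ?_)
  · rw [← lie_skew]
    exact neg_mem (hl _ d hd)
  · simp

/-- An atom of the lattice of submodules is an irreducible module. -/
theorem isIrreducible_of_isAtom {R S M : Type*} [CommRing R] [LieRing S] [LieAlgebra R S]
    [AddCommGroup M] [Module R M] [LieRingModule S M] [LieModule R S M]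
    {V : LieSubmodule R S M} (hV : IsAtom V) : LieModule.IsIrreducible R S V := by
  have : Nontrivial V := (LieSubmodule.nontrivial_iff_ne_bot R S M).mpr hV.1
  refine LieModule.IsIrreducible.mk fun N hN => ?_
  have hle : N.map V.incl ≤ V := by
    rintro _ ⟨x, -, rfl⟩
    exact x.2
  have hne : N.map V.incl ≠ ⊥ := fun h => hN <| by
    rw [LieSubmodule.eq_bot_iff] at h ⊢
    exact fun x hx => Subtype.ext (h x ⟨x, hx, rfl⟩)
  have heq := (hV.le_iff.mp hle).resolve_left hne
  rw [eq_top_iff]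
  rintro ⟨x, hx⟩ -
  rw [← heq] at hx
  obtain ⟨y, hy, hyx⟩ := hx
  rwa [← show y = ⟨x, _⟩ from Subtype.ext hyx]

/-- A nontrivial irreducible submodule `W` satisfies `⁅S, W⁆ = W`, so lies in every submodule
containing `⁅S, W⁆`. -/
theorem le_of_forall_lie_mem {R S M : Type*} [CommRing R] [LieRing S] [LieAlgebra R S]
    [AddCommGroup M] [Module R M] [LieRingModule S M] [LieModule R S M]
    {W U : LieSubmodule R S M} [LieModule.IsIrreducible R S W] (hW : ¬ LieModule.IsTrivial S W)
    (h : ∀ (s : S), ∀ w ∈ W, ⁅s, w⁆ ∈ U) : W ≤ U := by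
  rcases eq_bot_or_eq_top (U.comap W.incl) with h0 | h1
  · refine absurd ⟨fun s w => ?_⟩ hW
    have : ⁅s, w⁆ ∈ U.comap W.incl := h s w w.2
    rw [h0] at this
    exact this
  · exact fun w hw => (h1 ▸ LieSubmodule.mem_top _ : (⟨w, hw⟩ : W) ∈ U.comap W.incl)

variable [CharZero F]

theorem finrank_center_le_one [Finite (LieIdeal F L)] : finrank F (center F L) ≤ 1 := by
  by_cases h : ∃ z ∈ center F L, z ≠ 0
  · obtain ⟨z, hz, hz0⟩ := h
    change finrank F (center F L).toSubmodule ≤ 1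
    rw [center_eq_span hz hz0]
    exact finrank_span_singleton hz0 |>.le
  · push Not at h
    have : Subsingleton (center F L) :=
      ⟨fun a b => Subtype.ext ((h a a.2).trans (h b b.2).symm)⟩
    rw [finrank_zero_of_subsingleton]
    exact zero_le

/-- An element of `C_L(L²)` outside `L²` commutes with `L² + F z = L`. -/
theorem exists_of_not_centralizer_derived_le [Finite (LieIdeal F L)]
    (h : ¬ centralizer (derived F L) ≤ (derived F L).toSubmodule) :
    ∃ z : L, z ≠ 0 ∧ IsDirectSum ⊤ (derived F L).toSubmodule (F ∙ z) ∧
      centralizer (derived F L) = (center F L).toSubmodule ∧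
      (center F L).toSubmodule = F ∙ z := by
  obtain ⟨z, hzC, hzD⟩ := SetLike.not_le_iff_exists.mp h
  have htop := derived_sup_span_eq_top hzD
  have hdis := disjoint_span_singleton_of_notMem hzD
  have hz0 : z ≠ 0 := fun h0 => hzD (h0 ▸ zero_mem _)
  have hcen : ∀ x ∈ centralizer (derived F L), ⁅x, z⁆ = 0 → x ∈ center F L := fun x hx hxz =>
    mem_center.mpr fun y => by
      obtain ⟨d, hd, w, hw, rfl⟩ := Submodule.mem_sup.mp (htop ▸ Submodule.mem_top : y ∈ _)
      obtain ⟨c, rfl⟩ := Submodule.mem_span_singleton.mp hw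
      rw [← lie_skew, lie_add, hx d hd, lie_smul, hxz, smul_zero, add_zero, neg_zero]
  have hz : z ∈ center F L := hcen z hzC (lie_self z)
  refine ⟨z, hz0, ⟨hdis, htop.symm⟩, le_antisymm
    (fun x hx => hcen x hx (mem_center.mp hz x)) (fun x hx y _ => lie_eq_zero_of_mem_center hx y),
    center_eq_span hz hz0⟩

theorem isLieAbelian_centralizer_derived [Finite (LieIdeal F L)] :
    IsLieAbelian (centralizerIdeal (derived F L)) := by
  rw [LieSubmodule.lie_abelian_iff_lie_self_eq_bot, LieSubmodule.lie_eq_bot_iff]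
  intro x hx y hy
  by_cases h : centralizer (derived F L) ≤ (derived F L).toSubmodule
  · exact hx y (h hy)
  · obtain ⟨z, -, -, h2, -⟩ := exists_of_not_centralizer_derived_le h
    have hy' : y ∈ (center F L).toSubmodule := h2 ▸ hy
    exact mem_center.mp hy' x

variable [FiniteDimensional F L] {S : LieSubalgebra F L}

theorem IsLeviFactor.nilCenterTriv_le (hS : IsLeviFactor S) :
    nilCenterTriv S ≤ centralizer (derived F L) := fun x hx y hy => by
  have hy' : y ∈ S.toSubmodule ⊔ (jacobson F L).toSubmodule := hS.derived_eq ▸ hy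
  obtain ⟨s, hs, j, hj, rfl⟩ := Submodule.mem_sup.mp hy'
  rw [lie_add, hx.1.2 j (hS.jacobson_le_nilradical hj), ← lie_skew, hx.2 s hs, neg_zero, add_zero]

/-- A complement of `Z₀(Nil(L))` in `Z(Nil(L))`, which exists by complete reducibility, is equal
to `Z₁(Nil(L))`. -/
theorem IsLeviFactor.nilCenter_eq (hS : IsLeviFactor S) :
    IsDirectSum (nilCenter F L) (nilCenterTriv S) (nilCenterNontriv S) := by
  have := hS.complementedLattice
  let Z : LieSubmodule F S L := restrictTo S (nilCenterIdeal F L)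
  let Z₀ : LieSubmodule F S L :=
    { nilCenterTriv S with
      lie_mem := fun {s x} hx => by
        rw [show ⁅s, x⁆ = 0 from hx.2 s s.2]
        exact zero_mem (nilCenterTriv S) }
  have hZ₀ : Z₀ ≤ Z := fun x hx => hx.1
  obtain ⟨C, hC⟩ := exists_isCompl Z₀
  have hsup : Z₀ ⊔ C ⊓ Z = Z := by
    rw [← sup_inf_assoc_of_le C hZ₀, hC.sup_eq_top, top_inf_eq]
  have hinf : Z₀ ⊓ (C ⊓ Z) = ⊥ := by rw [← inf_assoc, hC.inf_eq_bot, bot_inf_eq]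
  set W := C ⊓ Z
  have hW : nilCenterNontriv S = W.toSubmodule := by
    refine le_antisymm (sSup_le ?_) ?_
    · rintro _ ⟨V, rfl, hVZ, hV, hVt⟩
      refine le_of_forall_lie_mem (U := W) hVt fun s v hv => ?_
      have hvZ : v ∈ Z₀ ⊔ W := by rw [hsup]; exact hVZ hv
      obtain ⟨z, hz, w, hw, rfl⟩ := (LieSubmodule.mem_sup _ _ _).mp hvZ
      rw [lie_add, show ⁅s, z⁆ = 0 from hz.2 s s.2, zero_add]
      exact W.lie_mem hw
    · obtain ⟨t, ht, htA⟩ := eq_sSup_atoms W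
      rw [ht, LieSubmodule.sSup_toSubmodule]
      refine sSup_le ?_
      rintro _ ⟨V, hV, rfl⟩
      have hVW : V ≤ W := ht ▸ le_sSup hV
      refine le_sSup ⟨V, rfl, fun v hv => (hVW hv).2, isIrreducible_of_isAtom (htA V hV), ?_⟩
      intro htriv
      refine (htA V hV).1 (eq_bot_iff.mpr (hinf ▸ le_inf (fun v hv => ?_) hVW))
      exact ⟨(hVW hv).2, fun s hs => congrArg Subtype.val (htriv.trivial ⟨s, hs⟩ ⟨v, hv⟩)⟩
  rw [hW]
  refine ⟨?_, ?_⟩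
  · change Disjoint Z₀.toSubmodule W.toSubmodule
    rw [LieSubmodule.disjoint_toSubmodule, disjoint_iff]
    exact hinf
  · change Z.toSubmodule = Z₀.toSubmodule ⊔ W.toSubmodule
    rw [← LieSubmodule.sup_toSubmodule, hsup]

theorem IsLeviFactor.nilCenterNontriv_le (hS : IsLeviFactor S) :
    nilCenterNontriv S ≤ (jacobson F L).toSubmodule := by
  refine sSup_le ?_
  rintro _ ⟨V, rfl, hVZ, hV, hVt⟩
  exact le_of_forall_lie_mem (U := restrictTo S (jacobson F L)) hVt fun s v hv =>
    hS.lie_mem_jacobson s (nilradical_le_radical (hVZ hv).1)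

theorem IsLeviFactor.nilCenterTriv_le_jacobson (hS : IsLeviFactor S)
    (h : centralizer (derived F L) ≤ (derived F L).toSubmodule) :
    nilCenterTriv S ≤ (jacobson F L).toSubmodule := fun x hx => by
  have : x ∈ derived F L ⊓ radical F L :=
    ⟨h (hS.nilCenterTriv_le hx), nilradical_le_radical hx.1.1⟩
  rwa [hS.derived_inf_radical] at this

/-- If `C_L(L²) ≤ L²`, then both summands of `Z(Nil(L))` lie in `J(L)`; otherwise `L` splits off its
centre, and `Z(L) ≤ Z₀(Nil(L)) ≤ C_L(L²) = Z(L)`. -/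
theorem IsLeviFactor.exists_or_nilCenter_le [Finite (LieIdeal F L)] (hS : IsLeviFactor S) :
    (∃ z : L, z ≠ 0 ∧ IsDirectSum ⊤ (derived F L).toSubmodule (F ∙ z) ∧
      centralizer (derived F L) = (center F L).toSubmodule ∧
      (center F L).toSubmodule = F ∙ z ∧ F ∙ z = nilCenterTriv S) ∨
    nilCenter F L ≤ (jacobson F L).toSubmodule := by
  by_cases h : centralizer (derived F L) ≤ (derived F L).toSubmodule
  · right
    rw [hS.nilCenter_eq.2]
    exact sup_le (hS.nilCenterTriv_le_jacobson h) hS.nilCenterNontriv_le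
  · left
    obtain ⟨z, hz0, h1, h2, h3⟩ := exists_of_not_centralizer_derived_le h
    refine ⟨z, hz0, h1, h2, h3, le_antisymm ?_ ?_⟩
    · rw [← h3]
      exact center_le_nilCenterTriv S
    · rw [← h3, ← h2]
      exact hS.nilCenterTriv_le

/-- For solvable `L`, a nilpotent ideal not contained in `L²` is all of `L`, by
`eq_top_of_sup_radical_of_sup_derived`; but a nilpotent `L` with `dim L / L² ≤ 1` has `L² = 0`. -/
theorem IsLeviFactor.derived_eq_jacobson_of_eq_bot [Finite (LieIdeal F L)] (hS : IsLeviFactor S)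
    (h0 : S = ⊥) (hJ : jacobson F L ≠ ⊥) :
    derived F L = jacobson F L ∧ jacobson F L = nilradical F L := by
  have hDJ : derived F L = jacobson F L := by
    rw [← LieSubmodule.toSubmodule_inj, hS.derived_eq, h0]
    simp
  have hR : radical F L = ⊤ := by
    have := hS.2.sup_eq_top
    rw [h0, LieSubalgebra.bot_toSubmodule, bot_sup_eq, LieSubmodule.toSubmodule_eq_top] at this
    exact this
  refine ⟨hDJ, le_antisymm hS.jacobson_le_nilradical (sSup_le fun K hK => ?_)⟩
  rw [← hDJ]
  by_contra hKD
  obtain ⟨a, haK, haD⟩ := SetLike.not_le_iff_exists.mp hKD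
  have htop := derived_sup_span_eq_top haD
  have hKtop : K = ⊤ := by
    refine eq_top_of_sup_radical_of_sup_derived (by rw [hR, sup_top_eq]) ?_
    rw [← LieSubmodule.toSubmodule_eq_top, LieSubmodule.sup_toSubmodule, eq_top_iff, ← htop,
      sup_comm K.toSubmodule]
    exact sup_le_sup_left (by simpa using haK) _
  subst hKtop
  have hnil : LieRing.IsNilpotent L :=
    (LieEquiv.nilpotent_iff_equiv_nilpotent (LieSubalgebra.topEquiv (R := F) (L := L))).mp hK
  obtain ⟨k, hk⟩ := (LieModule.isNilpotent_iff F L L).mp hnil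
  have hle : ∀ k, derived F L ≤ LieModule.lowerCentralSeries F L L k := fun k => by
    induction k with
    | zero => exact le_top
    | succ k ih =>
      rw [LieModule.lowerCentralSeries_succ, ← lie_derived_eq_of_sup_span_eq_top htop]
      exact LieSubmodule.mono_lie le_rfl ih
  exact hJ (hDJ ▸ eq_bot_iff.mpr (hk ▸ hle k))

/-- The two cases are `Rad(L) ≤ L²` and `L = L² + F a` for some `a` in `Rad(L)` outside `L²`. -/
theorem IsLeviFactor.derived_eq_top_or_exists [Nontrivial L] [Finite (LieIdeal F L)]
    (hS : IsLeviFactor S) :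
    (derived F L = ⊤ ∧
      IsDirectSum ⊤ S.toSubmodule (jacobson F L).toSubmodule ∧ S ≠ ⊥ ∧
      radical F L = jacobson F L ∧ jacobson F L = nilradical F L) ∨
    (∃ a : L, a ≠ 0 ∧ IsDirectSum ⊤ (derived F L).toSubmodule (F ∙ a) ∧
      IsDirectSum (radical F L).toSubmodule (jacobson F L).toSubmodule (F ∙ a)) := by
  by_cases hRD : radical F L ≤ derived F L
  · left
    have hRJ : radical F L = jacobson F L := by
      rw [← hS.derived_inf_radical, inf_eq_right.mpr hRD]
    have hJN : jacobson F L = nilradical F L :=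
      le_antisymm hS.jacobson_le_nilradical (hRJ ▸ nilradical_le_radical)
    have htop : S.toSubmodule ⊔ (jacobson F L).toSubmodule = ⊤ := hRJ ▸ hS.2.sup_eq_top
    have hD : derived F L = ⊤ := by
      rw [← LieSubmodule.toSubmodule_eq_top, hS.derived_eq, htop]
    refine ⟨hD, ⟨hRJ ▸ hS.2.disjoint, htop.symm⟩, fun h0 => ?_, hRJ, hJN⟩
    have hR : radical F L = ⊤ := by
      have := hS.2.sup_eq_top
      rw [h0, LieSubalgebra.bot_toSubmodule, bot_sup_eq, LieSubmodule.toSubmodule_eq_top] at this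
      exact this
    have : (⊥ : LieIdeal F L) = ⊤ :=
      eq_top_of_sup_radical_of_sup_derived (by rw [hR, sup_top_eq]) (by rw [hD, sup_top_eq])
    exact bot_ne_top this
  · right
    obtain ⟨a, haR, haD⟩ := SetLike.not_le_iff_exists.mp hRD
    have htop := derived_sup_span_eq_top haD
    have hspan : F ∙ a ≤ (radical F L).toSubmodule := by simpa using haR
    refine ⟨a, fun h0 => haD (h0 ▸ zero_mem _),
      ⟨disjoint_span_singleton_of_notMem haD, htop.symm⟩,
      disjoint_span_singleton_of_notMem fun h => haD (hS.jacobson_le_derived h), ?_⟩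
    rw [← hS.derived_inf_radical, LieSubmodule.inf_toSubmodule, sup_comm, inf_comm,
      inf_comm, ← sup_inf_assoc_of_le _ hspan, sup_comm, htop, top_inf_eq]

end Centre

/-! ### Ideals meeting the Jacobson radical trivially -/

section SimpleIdeals

variable {F L : Type*} [Field F] [LieRing L] [LieAlgebra F L]

theorem le_or_inf_eq_bot_of_isSimple {T : LieIdeal F L} (hT : LieAlgebra.IsSimple F T)
    (A : LieIdeal F L) : T ≤ A ∨ T ⊓ A = ⊥ := by
  rcases hT.eq_bot_or_eq_top (A.comap T.incl) with h | h
  · right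
    rw [LieSubmodule.eq_bot_iff]
    rintro x ⟨hx, hxA⟩
    have : (⟨x, hx⟩ : T) ∈ A.comap T.incl := LieIdeal.mem_comap.mpr hxA
    rw [h] at this
    exact congrArg Subtype.val this
  · left
    intro x hx
    have : (⟨x, hx⟩ : T) ∈ A.comap T.incl := h ▸ LieSubmodule.mem_top _
    exact LieIdeal.mem_comap.mp this

theorem inf_radical_eq_bot_of_isSimple [IsNoetherian F L] {T : LieIdeal F L}
    (hT : LieAlgebra.IsSimple F T) : T ⊓ radical F L = ⊥ := by
  refine (le_or_inf_eq_bot_of_isSimple hT _).resolve_left fun h => ?_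
  have hsol : IsSolvable T := (LieIdeal.solvable_iff_le_radical F L T).mpr h
  have h0 : radical F T = ⊥ := HasTrivialRadical.radical_eq_bot
  rw [radical_eq_top_of_isSolvable] at h0
  have := IsSimple.nontrivial F (L := T)
  exact top_ne_bot h0

/-- If `T` is simple and `x = a + t` lies in the radical, with `a` in an ideal meeting `T`
trivially, then `t` centralizes `T`, so `t = 0`. -/
theorem sup_inf_radical_eq_bot [IsNoetherian F L] {A T : LieIdeal F L}
    (hT : LieAlgebra.IsSimple F T) (hA : A ⊓ radical F L = ⊥) : (T ⊔ A) ⊓ radical F L = ⊥ := by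
  rcases le_or_inf_eq_bot_of_isSimple hT A with h | h
  · rwa [sup_eq_right.mpr h]
  have hTR := inf_radical_eq_bot_of_isSimple hT
  rw [LieSubmodule.eq_bot_iff]
  rintro x ⟨hx, hxR⟩
  obtain ⟨t, ht, a, ha, rfl⟩ := (LieSubmodule.mem_sup _ _ _).mp hx
  have hcen : (⟨t, ht⟩ : T) ∈ center F T := mem_center.mpr fun y => by
    have h1 : ⁅(y : L), t + a⁆ = 0 := by
      have : ⁅(y : L), t + a⁆ ∈ T ⊓ radical F L :=
        ⟨lie_mem_left F L T _ _ y.2, lie_mem_right F L _ _ _ hxR⟩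
      rwa [hTR] at this
    have h2 : ⁅(y : L), a⁆ = 0 := by
      have : ⁅(y : L), a⁆ ∈ T ⊓ A := ⟨lie_mem_left F L T _ _ y.2, lie_mem_right F L _ _ _ ha⟩
      rwa [h] at this
    rw [lie_add, h2, add_zero] at h1
    exact Subtype.ext h1
  have hbot : center F T = ⊥ := by
    rw [eq_bot_iff, ← HasTrivialRadical.radical_eq_bot (R := F) (L := T)]
    exact center_le_radical F T
  rw [hbot] at hcen
  have ht0 : t = 0 := congrArg Subtype.val hcen
  subst ht0
  rw [zero_add] at hxR ⊢
  have : a ∈ A ⊓ radical F L := ⟨ha, hxR⟩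
  rwa [hA] at this

theorem IsSumOfSimpleIdeals.inf_radical_eq_bot [IsNoetherian F L] [Finite (LieIdeal F L)]
    {K : LieIdeal F L} (hK : IsSumOfSimpleIdeals K) : K ⊓ radical F L = ⊥ := by
  obtain ⟨T, hT, rfl⟩ := hK
  induction T, T.toFinite using Set.Finite.induction_on with
  | empty => simp
  | insert _ _ ih =>
    rw [sSup_insert]
    exact sup_inf_radical_eq_bot (hT _ (Set.mem_insert _ _))
      (ih fun K hK => hT K (Set.mem_insert_of_mem _ hK))

variable [CharZero F] [FiniteDimensional F L]

/-- The radical of the Killing form of an ideal `T` is `T ∩ Tᗮ`, a solvable ideal of `L` by Cartan's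
criterion. -/
theorem isKilling_of_inf_radical_eq_bot {T : LieIdeal F L} (hT : T ⊓ radical F L = ⊥) :
    LieAlgebra.IsKilling F T := by
  constructor
  rw [LieSubmodule.eq_bot_iff]
  intro x hx
  rw [LieIdeal.mem_killingCompl] at hx
  let Q : LieIdeal F L := T ⊓ LieIdeal.killingCompl F L T
  have hQ : IsSolvable Q := by
    refine LieIdeal.isSolvable_of_killingForm_apply_lie_eq_zero Q fun a ha b hb => ?_
    have hb' : b ∈ Q := LieSubmodule.lie_le_left _ _ hb
    rw [LieModule.traceForm_comm, LieModule.traceForm_comm]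
    exact (LieIdeal.mem_killingCompl F L T).mp hb'.2 a ha.1
  have hQbot : Q = ⊥ := eq_bot_iff.mpr <| hT ▸ le_inf inf_le_left
    ((LieIdeal.solvable_iff_le_radical F L Q).mp hQ)
  have hxQ : (x : L) ∈ Q := by
    refine ⟨x.2, (LieIdeal.mem_killingCompl F L T).mpr fun y hy => ?_⟩
    have := hx ⟨y, hy⟩ (LieSubmodule.mem_top _)
    exact (LinearMap.congr_fun₂ (LieIdeal.killingForm_eq F L T) ⟨y, hy⟩ x).symm.trans this
  rw [hQbot] at hxQ
  exact Subtype.ext hxQ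

/-- An ideal meeting the radical trivially is a perfect Lie algebra. -/
theorem le_lie_self_of_inf_radical_eq_bot {T : LieIdeal F L} (hT : T ⊓ radical F L = ⊥) :
    T ≤ ⁅T, T⁆ := fun t ht => by
  have := isKilling_of_inf_radical_eq_bot hT
  have h := linearMap_eq_zero_of_forall_lie (F := F) (S := T)
    ((⁅T, T⁆ : LieIdeal F L).toSubmodule.mkQ ∘ₗ T.toSubmodule.subtype) fun x y =>
      (Submodule.Quotient.mk_eq_zero _).mpr (LieSubmodule.lie_mem_lie x.2 y.2)
  exact (Submodule.Quotient.mk_eq_zero _).mp (LinearMap.congr_fun h (⟨t, ht⟩ : T))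

/-- A minimal ideal that meets the radical trivially is simple: its own ideals are perfect, hence
ideals of `L`. -/
theorem isSimple_of_isAtom_of_inf_radical_eq_bot {T : LieIdeal F L} (hT : IsAtom T)
    (hTR : T ⊓ radical F L = ⊥) : LieAlgebra.IsSimple F T := by
  have := isKilling_of_inf_radical_eq_bot hTR
  refine ⟨fun U => ?_, fun hab => ?_⟩
  · let U' : LieIdeal F L :=
      { U.toSubmodule.map T.toSubmodule.subtype with
        lie_mem := fun {y m} hm => by
          obtain ⟨(u : T), hu, rfl⟩ := hm
          -- `U = ⁅U, U⁆` is stable under the derivation `D` of `T` induced by `y`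
          let D : T →ₗ[F] T :=
            { toFun := fun t => ⟨⁅y, (t : L)⁆, T.lie_mem t.2⟩
              map_add' := fun a b => Subtype.ext (lie_add y (a : L) b)
              map_smul' := fun c a => Subtype.ext (lie_smul c y (a : L)) }
          have hu' : u ∈ ⁅U, U⁆ := by rwa [lie_self_eq_of_hasTrivialRadical]
          have hD : u ∈ U.toSubmodule.comap D := lie_lieIdeal_induction (fun a ha b hb => by
            have : D ⁅a, b⁆ = ⁅D a, b⁆ + ⁅a, D b⁆ := Subtype.ext (leibniz_lie y (a : L) (b : L))
            rw [Submodule.mem_comap, this]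
            exact add_mem (lie_mem_right F T U _ _ hb) (lie_mem_left F T U _ _ ha)) hu'
          exact ⟨D u, hD, rfl⟩ }
    have hU' : U' ≤ T := by
      rintro _ ⟨u, -, rfl⟩
      exact u.2
    rcases hT.le_iff.mp hU' with h | h
    · left
      rw [LieSubmodule.eq_bot_iff] at h ⊢
      exact fun u hu => Subtype.ext (h u ⟨u, hu, rfl⟩)
    · right
      rw [eq_top_iff]
      rintro ⟨t, ht⟩ -
      rw [← h] at ht
      obtain ⟨u, hu, hut⟩ := ht
      rwa [← show u = ⟨t, _⟩ from Subtype.ext hut]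
  · refine hT.1 (eq_bot_iff.mpr (hTR ▸ le_inf le_rfl ?_))
    exact (LieIdeal.solvable_iff_le_radical F L T).mp inferInstance

variable {S : LieSubalgebra F L}

/-- The `ad S`-submodules of an ideal centralized by the radical are ideals, so that complete
reducibility writes such an ideal as a sum of minimal ideals. -/
theorem IsLeviFactor.eq_sSup_atoms (hS : IsLeviFactor S) {K : LieIdeal F L}
    (hK : ∀ r ∈ radical F L, ∀ k ∈ K, ⁅r, k⁆ = 0) :
    K = sSup {T : LieIdeal F L | IsAtom T ∧ T ≤ K} := by
  have := hS.complementedLattice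
  refine le_antisymm (fun x hx => ?_) (sSup_le fun T hT => hT.2)
  obtain ⟨s, hs, hsA⟩ := _root_.eq_sSup_atoms (restrictTo S K)
  suffices h : restrictTo S K ≤ restrictTo S (sSup {T : LieIdeal F L | IsAtom T ∧ T ≤ K}) from h hx
  rw [hs]
  refine sSup_le fun U hU => ?_
  have hUK : U ≤ restrictTo S K := hs ▸ le_sSup hU
  let I := hS.toIdeal U fun r hr u hu => by
    rw [hK r hr u (hUK hu)]
    exact zero_mem U
  have hI : IsAtom I := by
    refine ⟨fun h => (hsA U hU).1 ?_, fun A hA => ?_⟩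
    · rw [LieSubmodule.eq_bot_iff] at h ⊢
      exact h
    · have h1 : restrictTo S A = ⊥ := (hsA U hU).2 _ <| by
        refine lt_of_le_of_ne (fun y hy => hA.le hy) fun h => hA.ne ?_
        ext y
        rw [← mem_restrictTo (S := S) (I := A), h]
        rfl
      rw [LieSubmodule.eq_bot_iff] at h1 ⊢
      exact h1
  exact fun u hu => (le_sSup (⟨hI, fun y hy => hUK hy⟩ :
    I ∈ {T : LieIdeal F L | IsAtom T ∧ T ≤ K}) : I ≤ _) hu

theorem IsLeviFactor.isSumOfSimpleIdeals (hS : IsLeviFactor S) {K : LieIdeal F L}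
    (hK : K ⊓ radical F L = ⊥) : IsSumOfSimpleIdeals K := by
  refine ⟨{T : LieIdeal F L | IsAtom T ∧ T ≤ K}, fun T hT => ?_,
    hS.eq_sSup_atoms fun r hr k hk => ?_⟩
  · exact isSimple_of_isAtom_of_inf_radical_eq_bot hT.1
      (eq_bot_iff.mpr (hK ▸ inf_le_inf_right _ hT.2))
  · have : ⁅r, k⁆ ∈ K ⊓ radical F L := ⟨lie_mem_right F L _ _ _ hk, lie_mem_left F L _ _ _ hr⟩
    rw [hK] at this
    exact this

theorem IsLeviFactor.inf_radical_le_center (hS : IsLeviFactor S) {I : LieIdeal F L}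
    (hI : I ⊓ jacobson F L = ⊥) : I ⊓ radical F L ≤ center F L := fun x hx =>
  mem_center.mpr fun y => by
    have : ⁅y, x⁆ ∈ I ⊓ jacobson F L := ⟨I.lie_mem hx.1, hS.lie_mem_jacobson y hx.2⟩
    rwa [hI] at this

/-- An ideal `I` with `I ∩ J(L) = 0` is centralized by the radical, so an `ad S`-complement of
`I ∩ Rad(L)` in `I` is an ideal. -/
theorem IsLeviFactor.exists_isDirectSum (hS : IsLeviFactor S) {I : LieIdeal F L}
    (hI : I ⊓ jacobson F L = ⊥) : ∃ K : LieIdeal F L, IsSumOfSimpleIdeals K ∧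
      IsDirectSum I.toSubmodule K.toSubmodule (I ⊓ radical F L).toSubmodule := by
  have := hS.complementedLattice
  obtain ⟨C, hC⟩ := exists_isCompl (restrictTo S (I ⊓ radical F L))
  let K : LieIdeal F L := hS.toIdeal (C ⊓ restrictTo S I) fun r hr u hu => by
    have : ⁅r, u⁆ ∈ I ⊓ jacobson F L := by
      refine ⟨I.lie_mem hu.2, ?_⟩
      rw [← lie_skew]
      exact neg_mem (hS.lie_mem_jacobson u hr)
    rw [hI] at this
    rw [show ⁅r, u⁆ = 0 from this]
    exact zero_mem _
  have hKR : K ⊓ (I ⊓ radical F L) = ⊥ := by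
    rw [LieSubmodule.eq_bot_iff]
    rintro x ⟨hx, hx'⟩
    have : x ∈ restrictTo S (I ⊓ radical F L) ⊓ C := ⟨hx', hx.1⟩
    rw [hC.inf_eq_bot] at this
    exact this
  refine ⟨K, hS.isSumOfSimpleIdeals ?_, ?_, ?_⟩
  · have hKI : K ≤ I := fun x hx => hx.2
    rwa [← inf_assoc, inf_eq_left.mpr hKI] at hKR
  · rw [LieSubmodule.disjoint_toSubmodule, disjoint_iff, hKR]
  · have h : restrictTo S (I ⊓ radical F L) ⊔ C ⊓ restrictTo S I = restrictTo S I := by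
      rw [← sup_inf_assoc_of_le C (fun x hx => hx.1 :
        restrictTo S (I ⊓ radical F L) ≤ restrictTo S I), hC.sup_eq_top, top_inf_eq]
    rw [sup_comm]
    have := congrArg LieSubmodule.toSubmodule h.symm
    rwa [LieSubmodule.sup_toSubmodule] at this

theorem IsLeviFactor.inf_jacobson_eq_bot_iff [Finite (LieIdeal F L)] (hS : IsLeviFactor S)
    (I : LieIdeal F L) : I ⊓ jacobson F L = ⊥ ↔
      (I = ⊥ ∨ IsSumOfSimpleIdeals I ∨
        (IsDirectSum ⊤ (derived F L).toSubmodule (center F L).toSubmodule ∧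
          (∃ z : L, z ≠ 0 ∧ (center F L).toSubmodule = F ∙ z) ∧
          (I = center F L ∨
            ∃ K : LieIdeal F L, IsSumOfSimpleIdeals K ∧
              IsDirectSum I.toSubmodule K.toSubmodule (center F L).toSubmodule))) := by
  constructor
  · intro hI
    obtain ⟨K, hK, hIK⟩ := hS.exists_isDirectSum hI
    right
    by_cases h0 : I ⊓ radical F L = ⊥
    · left
      have h2 := hIK.2
      rw [h0, LieSubmodule.bot_toSubmodule, sup_bot_eq, LieSubmodule.toSubmodule_inj] at h2
      rwa [h2]
    · right
      obtain ⟨z, hz, hz0⟩ : ∃ z ∈ I ⊓ radical F L, z ≠ 0 := by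
        rw [LieSubmodule.eq_bot_iff] at h0
        push Not at h0
        exact h0
      have hle := hS.inf_radical_le_center hI
      have hcen := center_eq_span (hle hz) hz0
      have heq : I ⊓ radical F L = center F L := by
        refine le_antisymm hle ?_
        rw [← LieSubmodule.toSubmodule_le_toSubmodule, hcen]
        simpa using hz
      have hzD : z ∉ derived F L := fun h => hz0 <| by
        have h1 : z ∈ jacobson F L := hS.derived_inf_radical ▸ ⟨h, hz.2⟩
        have h2 : z ∈ I ⊓ jacobson F L := ⟨hz.1, h1⟩
        rwa [hI] at h2
      refine ⟨⟨?_, ?_⟩, ⟨z, hz0, hcen⟩, Or.inr ⟨K, hK, heq ▸ hIK⟩⟩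
      · rw [hcen]
        exact disjoint_span_singleton_of_notMem hzD
      · rw [hcen, derived_sup_span_eq_top hzD]
  · have hsum : ∀ K : LieIdeal F L, IsSumOfSimpleIdeals K → K ⊓ jacobson F L = ⊥ := fun K hK =>
      eq_bot_iff.mpr (hK.inf_radical_eq_bot ▸ inf_le_inf_left _ hS.jacobson_le_radical)
    rintro (rfl | hI | ⟨hD, -, rfl | ⟨K, hK, hIK⟩⟩)
    · exact bot_inf_eq _
    · exact hsum I hI
    · have h := hD.1
      rw [LieSubmodule.disjoint_toSubmodule, disjoint_comm] at h
      exact (h.mono_right hS.jacobson_le_derived).eq_bot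
    · rw [LieSubmodule.eq_bot_iff]
      rintro x ⟨hx, hxJ⟩
      have hx' : x ∈ K.toSubmodule ⊔ (center F L).toSubmodule := hIK.2 ▸ hx
      obtain ⟨k, hk, z, hz, rfl⟩ := Submodule.mem_sup.mp hx'
      have hkD : k ∈ derived F L :=
        (LieSubmodule.mono_lie le_top le_top : ⁅K, K⁆ ≤ derived F L)
          (le_lie_self_of_inf_radical_eq_bot hK.inf_radical_eq_bot hk)
      have hzD : z ∈ (derived F L).toSubmodule := by
        rw [← add_sub_cancel_left k z]
        exact sub_mem (hS.jacobson_le_derived hxJ) hkD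
      have hz0 : z = 0 := Submodule.disjoint_def.mp hD.1 z hzD hz
      subst hz0
      rw [add_zero] at hxJ ⊢
      have : k ∈ K ⊓ jacobson F L := ⟨hk, hxJ⟩
      rwa [hsum K hK] at this

/-- A perfect ideal `I` centralized by the radical lies in `S`: by induction it lies in
`S + Rad(L)⁽ᵏ⁾` for every `k`, since `⁅s + r, s' + r'⁆ = ⁅s, s'⁆ - ⁅r, r'⁆` when `s + r` and
`s' + r'` centralize the radical. -/
theorem IsLeviFactor.le_of_inf_radical_eq_bot (hS : IsLeviFactor S) {I : LieIdeal F L}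
    (hI : I ⊓ radical F L = ⊥) : I.toSubmodule ≤ S.toSubmodule := by
  have hzero : ∀ x ∈ I, ∀ r ∈ radical F L, ⁅x, r⁆ = 0 := fun x hx r hr => by
    have : ⁅x, r⁆ ∈ I ⊓ radical F L := ⟨lie_mem_left F L _ _ _ hx, lie_mem_right F L _ _ _ hr⟩
    rwa [hI] at this
  have key : ∀ k, I.toSubmodule ≤
      S.toSubmodule ⊔ (derivedSeriesOfIdeal F L k (radical F L)).toSubmodule := fun k => by
    induction k with
    | zero =>
      rw [derivedSeriesOfIdeal_zero, hS.2.sup_eq_top]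
      exact le_top
    | succ k ih =>
      intro x hx
      refine lie_lieIdeal_induction (fun u hu v hv => ?_) (le_lie_self_of_inf_radical_eq_bot hI hx)
      obtain ⟨s, hs, r, hr, rfl⟩ := Submodule.mem_sup.mp (ih hu)
      obtain ⟨s', hs', r', hr', rfl⟩ := Submodule.mem_sup.mp (ih hv)
      have hle := derivedSeriesOfIdeal_le_self (R := F) (L := L) (radical F L) k
      have h1 : ⁅s, r'⁆ = -⁅r, r'⁆ := by
        rw [← add_eq_zero_iff_eq_neg, ← add_lie]
        exact hzero _ hu _ (hle hr')
      have h2 : ⁅r, s'⁆ = -⁅r, r'⁆ := by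
        rw [← add_eq_zero_iff_eq_neg, ← lie_add, ← lie_skew, hzero _ hv _ (hle hr), neg_zero]
      have h3 : ⁅s + r, s' + r'⁆ = ⁅s, s'⁆ - ⁅r, r'⁆ := by
        rw [lie_add, add_lie, add_lie s r r', h1, h2]
        abel
      rw [h3]
      refine sub_mem (Submodule.mem_sup_left (S.lie_mem hs hs')) (Submodule.mem_sup_right ?_)
      rw [derivedSeriesOfIdeal_succ]
      exact LieSubmodule.lie_mem_lie hr hr'
  obtain ⟨k, hk⟩ := IsSolvable.solvable F (radical F L)
  rw [LieIdeal.derivedSeries_eq_bot_iff] at hk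
  have := key k
  rwa [hk, LieSubmodule.bot_toSubmodule, sup_bot_eq] at this

theorem IsLeviFactor.inf_jacobson_ne_bot (hS : IsLeviFactor S) (hf : IsFaithfulAlg S)
    (hc : center F L = ⊥) {I : LieIdeal F L} (hI : I ≠ ⊥) : I ⊓ jacobson F L ≠ ⊥ := fun h => by
  have hR : I ⊓ radical F L = ⊥ := eq_bot_iff.mpr (hc ▸ hS.inf_radical_le_center h)
  refine hI ((LieSubmodule.eq_bot_iff _).mpr fun x hx => ?_)
  refine hf x (hS.le_of_inf_radical_eq_bot hR hx) fun r hr => ?_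
  have : ⁅x, r⁆ ∈ I ⊓ radical F L := ⟨lie_mem_left F L _ _ _ hx, lie_mem_right F L _ _ _ hr⟩
  rwa [hR] at this

end SimpleIdeals

/-! ### The abelian socle and quotients -/

section AbelianSocle

variable {F L : Type*} [Field F] [LieRing L] [LieAlgebra F L]

/-- If `⁅K, A⁆ = A` for an ideal `K`, then `A` lies in every term of the lower central series of
`K`. -/
theorem eq_bot_of_le_lie_of_isNilpotent {K A : LieIdeal F L} (hK : LieRing.IsNilpotent K)
    (hA : A ≤ ⁅K, A⁆) : A = ⊥ := by
  have key : ∀ k, A.toSubmodule ≤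
      (LieModule.lowerCentralSeries F K K k).toSubmodule.map K.toSubmodule.subtype := fun k => by
    induction k with
    | zero =>
      exact fun x hx => ⟨⟨x, LieSubmodule.lie_le_left K A (hA hx)⟩, trivial, rfl⟩
    | succ k ih =>
      intro x hx
      refine lie_lieIdeal_induction (fun u hu v hv => ?_) (hA hx)
      obtain ⟨w, hw, rfl⟩ := ih hv
      refine ⟨⁅(⟨u, hu⟩ : K), w⁆, ?_, rfl⟩
      rw [LieModule.lowerCentralSeries_succ]
      exact LieSubmodule.lie_mem_lie (LieSubmodule.mem_top _) hw
  obtain ⟨k, hk⟩ := (LieModule.isNilpotent_iff F K K).mp hK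
  have := key k
  rw [hk, LieSubmodule.bot_toSubmodule, Submodule.map_bot] at this
  rwa [← LieSubmodule.toSubmodule_eq_bot, eq_bot_iff]

theorem asoc_le_nilCenterIdeal : asoc F L ≤ nilCenterIdeal F L := by
  refine sSup_le fun A hA => ?_
  have hab : ⁅A, A⁆ = ⊥ := (LieSubmodule.lie_abelian_iff_lie_self_eq_bot A).mp hA.2
  have hAN : A ≤ nilradical F L := le_sSup (isNilpotent_of_lie_self_eq_bot hab)
  refine le_inf hAN fun x hx y hy => ?_
  -- it suffices to treat each nilpotent ideal, as the centralizer of `A` is an ideal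
  have hle : nilradical F L ≤ centralizerIdeal A := sSup_le fun K hK => by
    have h0 : ⁅K, A⁆ = ⊥ := by
      refine (hA.1.le_iff.mp (LieSubmodule.lie_le_right A K)).resolve_right fun h => ?_
      exact hA.1.1 (eq_bot_of_le_lie_of_isNilpotent hK h.ge)
    exact fun k hk a ha => (LieSubmodule.lie_eq_bot_iff _ _).mp h0 k hk a ha
  rw [← lie_skew, mem_centralizer.mp (hle hy) x hx, neg_zero]

variable [CharZero F] [FiniteDimensional F L] {S : LieSubalgebra F L}

/-- If the radical annihilates `Z(Nil(L))`, then `Z(Nil(L))` is completely reducible as an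
`L`-module, so it is the sum of the minimal ideals it contains. -/
theorem IsLeviFactor.asoc_eq_nilCenterIdeal (hS : IsLeviFactor S)
    (h : ∀ r ∈ radical F L, ∀ x ∈ nilCenterIdeal F L, ⁅r, x⁆ = 0) :
    asoc F L = nilCenterIdeal F L := by
  refine le_antisymm asoc_le_nilCenterIdeal ?_
  rw [hS.eq_sSup_atoms h]
  refine sSup_le_sSup fun T hT => ⟨hT.1, ?_⟩
  rw [LieSubmodule.lie_abelian_iff_lie_self_eq_bot, LieSubmodule.lie_eq_bot_iff]
  exact fun x hx y hy => (hT.2 hx).2 y (hT.2 hy).1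

theorem IsLeviFactor.asoc_eq_or_nilCenter_le [Finite (LieIdeal F L)] (hS : IsLeviFactor S) :
    (∃ z : L, z ≠ 0 ∧ (asoc F L).toSubmodule = nilCenter F L ∧
      IsDirectSum (nilCenter F L) (asoc F L ⊓ jacobson F L).toSubmodule (F ∙ z) ∧
      (center F L).toSubmodule = F ∙ z ∧ F ∙ z = nilCenterTriv S) ∨
    nilCenter F L ≤ (jacobson F L).toSubmodule := by
  refine hS.exists_or_nilCenter_le.imp_left ?_
  rintro ⟨z, hz0, hD, -, hZ, hZ₀⟩
  have hz : z ∈ center F L := by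
    have : z ∈ (center F L).toSubmodule := hZ ▸ Submodule.mem_span_singleton_self z
    exact this
  have hzJ : z ∉ jacobson F L := fun h => hz0 <|
    Submodule.disjoint_def.mp hD.1 z (hS.jacobson_le_derived h)
      (Submodule.mem_span_singleton_self z)
  -- `Rad(L) = J(L) + F z` annihilates `Z(Nil(L))`
  have hkill : ∀ r ∈ radical F L, ∀ x ∈ nilCenterIdeal F L, ⁅r, x⁆ = 0 := by
    intro r hr x hx
    obtain ⟨d, hd, w, hw, rfl⟩ := Submodule.mem_sup.mp (hD.2 ▸ Submodule.mem_top : r ∈ _)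
    obtain ⟨c, rfl⟩ := Submodule.mem_span_singleton.mp hw
    have hzR : c • z ∈ (radical F L).toSubmodule :=
      Submodule.smul_mem _ c (center_le_radical F L hz)
    have hdJ : d ∈ jacobson F L := by
      rw [← hS.derived_inf_radical]
      refine ⟨hd, ?_⟩
      have := sub_mem hr hzR
      rwa [add_sub_cancel_right] at this
    rw [add_lie, smul_lie, lie_eq_zero_of_mem_center hz, smul_zero, add_zero, ← lie_skew,
      hx.2 d (hS.jacobson_le_nilradical hdJ), neg_zero]
  have hasoc := hS.asoc_eq_nilCenterIdeal hkill
  refine ⟨z, hz0, by rw [hasoc]; rfl, ⟨?_, ?_⟩, hZ, hZ₀⟩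
  · exact disjoint_span_singleton_of_notMem fun h => hzJ h.2
  · have hZ₁ := hS.nilCenter_eq
    refine le_antisymm ?_ (sup_le ?_ ?_)
    · conv_lhs => rw [hZ₁.2]
      rw [← hZ₀, sup_comm]
      refine sup_le_sup_right ?_ _
      rw [LieSubmodule.inf_toSubmodule, hasoc]
      exact le_inf (le_sup_right.trans hZ₁.2.ge) hS.nilCenterNontriv_le
    · rw [hasoc]
      exact fun x hx => hx.1
    · rw [hZ₀, hZ₁.2]
      exact le_sup_left

end AbelianSocle

section Quotients

variable {F L : Type*} [Field F] [LieRing L] [LieAlgebra F L]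

theorem finite_lieIdeal_of_surjective {L' : Type*} [LieRing L'] [LieAlgebra F L']
    [Finite (LieIdeal F L)] (f : L →ₗ⁅F⁆ L') (hf : Function.Surjective f) :
    Finite (LieIdeal F L') := by
  refine Finite.of_injective (LieIdeal.comap f) fun I J h => ?_
  ext y
  obtain ⟨x, rfl⟩ := hf y
  rw [← LieIdeal.mem_comap, h, LieIdeal.mem_comap]

/-- The quotient map by an ideal, as a homomorphism of Lie algebras. -/
def quotientHom (I : LieIdeal F L) : L →ₗ⁅F⁆ L ⧸ I :=
  { (LieSubmodule.Quotient.mk' I : L →ₗ[F] L ⧸ I) with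
    map_lie' := rfl }

theorem quotientHom_surjective (I : LieIdeal F L) : Function.Surjective (quotientHom I) :=
  LieSubmodule.Quotient.surjective_mk' I

theorem basicStructure [CharZero F] [FiniteDimensional F L] [Nontrivial L] [Finite (LieIdeal F L)]
    {S : LieSubalgebra F L} (hS : IsLeviFactor S) : BasicStructure F L S where
  a := ⟨hS.derived_eq_top_or_exists, hS.derived_eq_jacobson_of_eq_bot⟩
  b := finrank_center_le_one
  c := by
    refine ⟨⟨exists_of_not_centralizer_derived_le, ?_⟩, fun h => ?_⟩
    · rintro ⟨z, hz0, hD, hC, hZ⟩ h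
      have hz : z ∈ F ∙ z := Submodule.mem_span_singleton_self z
      exact hz0 (Submodule.disjoint_def.mp hD.1 z (h (hC ▸ hZ ▸ hz)) hz)
    · obtain ⟨z, hz0, hD, hC, hZ⟩ := exists_of_not_centralizer_derived_le h
      have hz : z ∈ (center F L).toSubmodule := hZ ▸ Submodule.mem_span_singleton_self z
      refine ⟨(LieSubmodule.eq_bot_iff _).mpr fun x hx => ?_,
        finite_lieIdeal_derived hz hD.2.symm, derived_derived_eq_top hz hD.2.symm⟩
      have hxC : (x : L) ∈ centralizer (derived F L) := fun y hy =>
        congrArg Subtype.val (lie_eq_zero_of_mem_center hx ⟨y, hy⟩)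
      rw [hC, hZ] at hxC
      exact Subtype.ext (Submodule.disjoint_def.mp hD.1 x x.2 hxC)
  d := ⟨⟨centralizerIdeal (derived F L), rfl, isLieAbelian_centralizer_derived⟩,
    center_le_nilCenterTriv S, hS.nilCenterTriv_le, fun h0 => by
      refine le_antisymm (fun x hx => hx.1) fun x hx => ⟨hx, fun s hs => ?_⟩
      rw [h0, LieSubalgebra.mem_bot] at hs
      rw [hs, zero_lie]⟩
  e := ⟨hS.nilCenter_eq, hS.nilCenterNontriv_le⟩
  f := hS.exists_or_nilCenter_le
  g := hS.inf_jacobson_eq_bot_iff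
  h := fun hf hc _ hI => hS.inf_jacobson_ne_bot hf hc hI
  i := ⟨asoc_le_nilCenterIdeal, hS.asoc_eq_or_nilCenter_le⟩

end Quotients

end LieIdeals

theorem mainTheorem6 {F : Type*} {L : Type*} [Field F] [CharZero F] [LieRing L] [LieAlgebra F L]
    [FiniteDimensional F L] [Nontrivial L] [Finite (LieIdeal F L)]
    (S : LieSubalgebra F L) (hS : LieIdeals.IsLeviFactor S) :
    LieIdeals.BasicStructure F L S ∧
    (∀ (L' : Type*) [LieRing L'] [LieAlgebra F L'] (f : L →ₗ⁅F⁆ L'),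
      Function.Surjective f → Finite (LieIdeal F L')) ∧
    (∀ I : LieIdeal F L, I ≠ ⊤ → ∀ S' : LieSubalgebra F (L ⧸ I), LieIdeals.IsLeviFactor S' →
      LieIdeals.BasicStructure F (L ⧸ I) S') := by
  refine ⟨LieIdeals.basicStructure hS,
    fun L' _ _ f hf => LieIdeals.finite_lieIdeal_of_surjective f hf, fun I hI S' hS' => ?_⟩
  have : Finite (LieIdeal F (L ⧸ I)) :=
    LieIdeals.finite_lieIdeal_of_surjective _ (LieIdeals.quotientHom_surjective I)
  have : Nontrivial (L ⧸ I) := by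
    refine Submodule.Quotient.nontrivial_iff (p := I.toSubmodule) |>.mpr fun h => hI ?_
    rwa [LieSubmodule.toSubmodule_eq_top] at h
  exact LieIdeals.basicStructure hS'
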